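/- Let $\mathcal P=\{x\in\mathbb R^p: Cx\le d\}$, with $C\in\mathbb R^{m\times p}$ having rows $C_1,\dots,C_m$, be a compact polyhedron with more than one point, let $V$ be its finite set of vertices and $D$ its Euclidean diameter. Let $n\ge 1$ and, for $i=1,\dots,n$, let $f_i:\mathbb R^p\to\mathbb R$ be differentiable and strongly convex with parameter $\sigma_i>0$, with $L_i$-Lipschitz gradient. Put $F=\frac1n\sum_{i=1}^n f_i$, $F^*=\min_{x\in\mathcal P}F(x)$, $\sigma_F=\min_i\sigma_i$, $L_F=\max_i L_i$, and $$\Omega_{\mathcal P}=\frac{\min\{d_i-C_iv:\ v\in V,\ 1\le i\le m,\ C_iv<d_i\}}{\max\{\|C_i\|:\ C_iv<d_i\text{ for some }v\in V\}} .$$ The Pairwise Stochastic Frank-Wolfe algorithm (PSFW) is the following. Start at a vertex $x^{(1)}\in V$ with vertex weights $\mu^{(1)}_{x^{(1)}}=1$ and $\mu^{(1)}_v=0$ for the other vertices. At iteration $k=1,2,\dots$: 1. Draw $\xi_1,\dots,\xi_{m^{(k)}}$ independently (also of all earlier iterations) and uniformly from $\{1,\dots,n\}$. Put $F^{(k)}=\frac1{m^{(k)}}\sum_j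 f_{\xi_j}$, $g^{(k)}=\nabla F^{(k)}(x^{(k)})$ and $L^{(k)}=\frac1{m^{(k)}}\sum_j L_{\xi_j}$. 2. Choose a vertex $p^{(k)}\in\arg\min_{x\in\mathcal P}\langle g^{(k)},x\rangle$ and $u^{(k)}\in\arg\max_{v\in U^{(k)}}\langle g^{(k)},v\rangle$, where $U^{(k)}=\{v:\mu^{(k)}_v>0\}$, with any tie-breaking. Put $d^{(k)}=p^{(k)}-u^{(k)}$ and $\gamma^{(k)}_{\max}=\mu^{(k)}_{u^{(k)}}$. 3. Let $\gamma^{(k)}=\min\{-\langle g^{(k)},d^{(k)}\rangle/(L^{(k)}\|d^{(k)}\|^2),\gamma^{(k)}_{\max}\}$ (with the quotient read as $0$ if $d^{(k)}=0$), or let $\gamma^{(k)}$ be an exact line-search minimizer of $\gamma\mapsto F^{(k)}(x^{(k)}+\gamma d^{(k)})$ over $[0,\gamma^{(k)}_{\max}]$. 4. Set $x^{(k+1)}=x^{(k)}+\gamma^{(k)}d^{(k)}$, and obtain $\mu^{(k+1)}$ from $\mu^{(k)}$ by moving the weight $\gamma^{(k)}$ from $u^{(k)}$ to $p^{(k)}$.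 Optionally (the Carathéodory variant), in every iteration the new weights are then replaced by the weights of a convex representation of $x^{(k+1)}$ that uses at most $p+1$ of the vertices carrying positive weight. Let $N=p+1$ for this variant and $N=|V|$ otherwise. Put $$\kappa=\min\Big\{\frac12,\ \frac{\Omega_{\mathcal P}^2\,\sigma_F}{8N^2L_FD^2}\Big\},\qquad m^{(k)}=\Big\lceil \frac1{(1-\kappa)^{2k+2}}\Big\rceil .$$ Then there are deterministic constants $0<\psi<\phi<\kappa$ and $C_3$, depending only on the problem data $C,d,(f_i),(\sigma_i),(L_i)$ and on the variant, such that every sequence of random vectors $\{x^{(k)}\}_{k\ge1}$ generated by PSFW satisfies the following: * $\mathbb E\{F(x^{(k+1)})-F^*\}\le C_3(1-\phi)^{k/(3|V|!+1)}$ for every $k\ge1$; * almost surely, $\dfrac{F(x^{(k)})-F^*}{(1-\psi)^{k/(3|V|!+1)}}\to0$ as $k\to\infty$. Hence $F(x^{(k)})$ converges linearly to $F^*$ almost surely: for almost every sample path there are $r\in(0,1)$ and $c$ with $|F(x^{(k)})-F^*|\le c\,r^k$ for all $k\ge1$. -/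

import Mathlib

open Set Filter Topology MeasureTheory ProbabilityTheory
open scoped NNReal ENNReal

noncomputable section

namespace PSFW

/-- The Euclidean space of dimension `p`. -/
abbrev Vec (p : ℕ) : Type := EuclideanSpace ℝ (Fin p)

section Problem

variable {p m n : ℕ}

/-- The polyhedron `{x | C x ≤ d}`; the vector `C i` is the `i`-th row of the matrix `C`. -/
def polyhedron (C : Fin m → Vec p) (d : Fin m → ℝ) : Set (Vec p) :=
  {x | ∀ i, inner ℝ (C i) x ≤ d i}

/-- The vertices (extreme points) of the polyhedron. -/
def vertices (C : Fin m → Vec p) (d : Fin m → ℝ) : Set (Vec p) :=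
  (polyhedron C d).extremePoints ℝ

/-- The objective `F(x) = (1/n) ∑ i, f_i(x)`. -/
def objective (f : Fin n → Vec p → ℝ) (x : Vec p) : ℝ :=
  (∑ i, f i x) / n

/-- The optimal value `F^*` of `F` over the polyhedron. -/
def optValue (C : Fin m → Vec p) (d : Fin m → ℝ) (f : Fin n → Vec p → ℝ) : ℝ :=
  sInf (objective f '' polyhedron C d)

/-- The smallest nonzero slack `d_i - C_i v` over the vertices `v` and the rows `i`. -/
def minSlack (C : Fin m → Vec p) (d : Fin m → ℝ) : ℝ :=
  sInf {t | ∃ v ∈ vertices C d, ∃ i, inner ℝ (C i) v < d i ∧ t = d i - inner ℝ (C i) v}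

/-- The largest norm of a row that is not active at all the vertices. -/
def maxRowNorm (C : Fin m → Vec p) (d : Fin m → ℝ) : ℝ :=
  sSup {t | ∃ i, (¬ ∀ v ∈ vertices C d, inner ℝ (C i) v = d i) ∧ t = ‖C i‖}

/-- The geometric constant `Ω_P` of the polytope. -/
def geomConst (C : Fin m → Vec p) (d : Fin m → ℝ) : ℝ :=
  minSlack C d / maxRowNorm C d

/-- The number `N` of vertices used to represent an iterate: `p + 1` if the Carathéodory reduction
is used (`carath = true`), and `|V|` otherwise. -/
def repSize (C : Fin m → Vec p) (d : Fin m → ℝ) (carath : Bool) : ℕ :=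
  if carath then p + 1 else (vertices C d).ncard

/-- The constant `κ = min {1/2, Ω_P² σ_F / (8 N² L_F D²)}`, where `σ_F = min σ_i`,
`L_F = max L_i` and `D` is the diameter of the polytope. -/
def kappa (C : Fin m → Vec p) (d : Fin m → ℝ) (σ : Fin n → ℝ) (L : Fin n → ℝ≥0)
    (carath : Bool) : ℝ :=
  min (1 / 2) (geomConst C d ^ 2 * (⨅ i, σ i) /
    (8 * (repSize C d carath : ℝ) ^ 2 * (⨆ i, (L i : ℝ)) * Metric.diam (polyhedron C d) ^ 2))

/-- The number of samples drawn at iteration `k`: `⌈1 / (1 - κ)^(2k+2)⌉`. -/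
def sampleSize (κ : ℝ) (k : ℕ) : ℕ := ⌈1 / (1 - κ) ^ (2 * k + 2)⌉₊

/-- The sampled objective `F^(k)(x) = (1/M) ∑_{j < M} f_{s_j}(x)`. -/
def sampleObjective (f : Fin n → Vec p → ℝ) (M : ℕ) (s : ℕ → Fin n) (x : Vec p) : ℝ :=
  (∑ j ∈ Finset.range M, f (s j) x) / M

/-- The stochastic gradient `g^(k) = (1/M) ∑_{j < M} ∇ f_{s_j}(x)`. -/
def sampleGradient (f : Fin n → Vec p → ℝ) (M : ℕ) (s : ℕ → Fin n) (x : Vec p) : Vec p :=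
  (M : ℝ)⁻¹ • ∑ j ∈ Finset.range M, gradient (f (s j)) x

/-- The sampled Lipschitz constant `L^(k) = (1/M) ∑_{j < M} L_{s_j}`. -/
def sampleLipschitz (L : Fin n → ℝ≥0) (M : ℕ) (s : ℕ → Fin n) : ℝ :=
  (∑ j ∈ Finset.range M, (L (s j) : ℝ)) / M

/-- The step size `γ` in the direction `dir` from `x`, with maximal step `γmax`: either
`min {-⟨g, dir⟩ / (L^(k) ‖dir‖²), γmax}`, or exact line search of the sampled objective
on `[0, γmax]`. (If `dir = 0`, the quotient is read as `0`; the iterate then stays where it is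
for every step size.) -/
def IsStepSize (f : Fin n → Vec p → ℝ) (L : Fin n → ℝ≥0) (M : ℕ) (s : ℕ → Fin n)
    (x dir : Vec p) (γmax γ : ℝ) : Prop :=
  γ = min (-(inner ℝ (sampleGradient f M s x) dir) / (sampleLipschitz L M s * ‖dir‖ ^ 2)) γmax ∨
  (γ ∈ Icc 0 γmax ∧ IsMinOn (fun t : ℝ => sampleObjective f M s (x + t • dir)) (Icc 0 γmax) γ)

/-- `w'` is a convex representation of `y` by at most `p + 1` of the vertices that carry weight
in `w`, as provided by Carathéodory's theorem. -/
def IsCaratheodoryReduction (y : Vec p) (w w' : Vec p →₀ ℝ) : Prop :=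
  w'.support ⊆ w.support ∧ w'.support.card ≤ p + 1 ∧ (∀ v, 0 ≤ w' v) ∧
    (∑ v ∈ w'.support, w' v = 1) ∧ (∑ v ∈ w'.support, w' v • v = y)

/-- One iteration of the pairwise stochastic Frank-Wolfe algorithm, with the samples
`s 0, …, s (M - 1)`, from the iterate `x` with vertex weights `w` to the iterate `x'` with vertex
weights `w'`. The set of active vertices is `w.support`; the iteration moves weight `γ` from
the active vertex `u` to the vertex `q`. -/
def IsStep (C : Fin m → Vec p) (d : Fin m → ℝ) (f : Fin n → Vec p → ℝ) (L : Fin n → ℝ≥0)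
    (carath : Bool) (M : ℕ) (s : ℕ → Fin n)
    (x : Vec p) (w : Vec p →₀ ℝ) (x' : Vec p) (w' : Vec p →₀ ℝ) : Prop :=
  ∃ (q u : Vec p) (γ : ℝ),
    q ∈ vertices C d ∧
    (∀ y ∈ polyhedron C d,
      inner ℝ (sampleGradient f M s x) q ≤ inner ℝ (sampleGradient f M s x) y) ∧
    u ∈ w.support ∧
    (∀ v ∈ w.support,
      inner ℝ (sampleGradient f M s x) v ≤ inner ℝ (sampleGradient f M s x) u) ∧
    IsStepSize f L M s x (q - u) (w u) γ ∧
    x' = x + γ • (q - u) ∧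
    (if carath then
      IsCaratheodoryReduction x' (w + Finsupp.single q γ - Finsupp.single u γ) w'
    else w' = w + Finsupp.single q γ - Finsupp.single u γ)

/-- The random sequence `x 1, x 2, …` is generated by the pairwise stochastic Frank-Wolfe
algorithm started at the vertex `x₁`, where `ξ k 0, …, ξ k (M k - 1)` are the samples drawn at
iteration `k`. The samples are independent and uniform on the indices. -/
structure IsRun (C : Fin m → Vec p) (d : Fin m → ℝ) (f : Fin n → Vec p → ℝ) (L : Fin n → ℝ≥0)
    (carath : Bool) (M : ℕ → ℕ) {Ω : Type*} [MeasurableSpace Ω] (P : Measure Ω)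
    (ξ : ℕ → ℕ → Ω → Fin n) (x₁ : Vec p) (x : ℕ → Ω → Vec p) : Prop where
  measurable_sample : ∀ k j, Measurable (ξ k j)
  uniform_sample : ∀ k j i, P {ω | ξ k j ω = i} = (n : ℝ≥0∞)⁻¹
  indep_sample : iIndepFun (fun (kj : ℕ × ℕ) => ξ kj.1 kj.2) P
  measurable_iterate : ∀ k, 1 ≤ k → Measurable (x k)
  start_mem : x₁ ∈ vertices C d
  path : ∀ ω, ∃ w : ℕ → Vec p →₀ ℝ,
    x 1 ω = x₁ ∧ w 1 = Finsupp.single x₁ 1 ∧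
    ∀ k, 1 ≤ k → IsStep C d f L carath (M k) (fun j => ξ k j ω)
      (x k ω) (w k) (x (k + 1) ω) (w (k + 1))

end Problem

/-- The sequence `a 1, a 2, …` converges linearly to `l`. -/
def ConvergesLinearly (a : ℕ → ℝ) (l : ℝ) : Prop :=
  ∃ r c : ℝ, 0 < r ∧ r < 1 ∧ ∀ k, 1 ≤ k → |a k - l| ≤ c * r ^ k

end PSFW

end

noncomputable section

namespace PSFW

/-! ### Polytope geometry: vertices, the constant `geomConst`, transport of vertex weights. -/

section Geometry

variable {p m : ℕ} {C : Fin m → Vec p} {d : Fin m → ℝ}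

/-! The argument is pathwise first; probability enters only at the end. All sampling error at one
iteration is dominated by one number, `deviation`, the ℓ¹ distance of the sampled frequencies from
the uniform law. It controls the sampled objective and gradient at every point of the polytope at
once, so the dependence of the iterate on earlier samples needs no conditioning.

Let h be the optimality gap. Strong convexity and the transport lemma `IsRep.exists_transport` show
that √h is at most a constant times the pairwise gap ⟨g, u - q⟩, up to noise
(`IsRep.optimality_gap_le`). An iteration then either lowers the sampled objective by a multiple of
h, or is a short maximal step that removes u from the active set (`IsStep.dichotomy`). In a window
of |V| + 1 iterations the second case cannot persist: short steps and small noise leave the gradient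
almost constant, a removed vertex would then be far from minimizing and could not reenter, and there
are only |V| vertices to remove (`exists_vertex_repeat`). Hence the gap contracts by a fixed factor
ρ < 1 over each window, up to a multiple of the summed deviations (`exists_contraction`).

The sample sizes make the expected deviation at iteration k at most n(1 - κ)^(k+1). Taking
expectations gives a linear recursion with geometric error, hence some rate r < 1 depending only on
the data (`exists_expected_rate`). Since φ may be taken as small as desired, r is dominated by (1 -
φ)^(1/(3|V|!+1)). With ψ < φ the normalized gaps have summable expectations, which gives almost sure
convergence. -/

theorem convex_polyhedron (C : Fin m → Vec p) (d : Fin m → ℝ) : Convex ℝ (polyhedron C d) := by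
  intro x hx y hy a b ha hb hab i
  have h1 := mul_le_mul_of_nonneg_left (hx i) ha
  have h2 := mul_le_mul_of_nonneg_left (hy i) hb
  rw [inner_add_right, inner_smul_right, inner_smul_right]
  calc _ ≤ a * d i + b * d i := add_le_add h1 h2
    _ = d i := by rw [← add_mul, hab, one_mul]

theorem mem_polyhedron_of_mem_vertices {v : Vec p} (hv : v ∈ vertices C d) :
    v ∈ polyhedron C d :=
  extremePoints_subset hv

/-- A point of the polyhedron can be moved a little away from any point that satisfies
the same active constraints. -/
theorem exists_extension {z v : Vec p} (hz : z ∈ polyhedron C d)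
    (h : ∀ i, inner ℝ (C i) z = d i → inner ℝ (C i) v = d i) :
    ∃ δ : ℝ, 0 < δ ∧ ∀ t : ℝ, 0 < t → t ≤ δ → z + t • (z - v) ∈ polyhedron C d := by
  have key : ∀ᶠ t in 𝓝[>] (0 : ℝ), ∀ i, inner ℝ (C i) (z + t • (z - v)) ≤ d i := by
    rw [eventually_all]
    intro i
    rcases (hz i).lt_or_eq with hi | hi
    · have hcont : Continuous fun t : ℝ => (inner ℝ (C i) (z + t • (z - v)) : ℝ) := by fun_prop
      have h0 : (inner ℝ (C i) (z + (0 : ℝ) • (z - v)) : ℝ) < d i := by simpa using hi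
      have := (hcont.tendsto 0).eventually_lt_const h0
      exact (this.filter_mono nhdsWithin_le_nhds).mono fun t ht => ht.le
    · refine Eventually.of_forall fun t => ?_
      rw [inner_add_right, inner_smul_right, inner_sub_right, hi, h i hi]
      simp
  obtain ⟨δ, hδ, hsub⟩ := (mem_nhdsGT_iff_exists_Ioc_subset).1 key
  exact ⟨δ, hδ, fun t h0 h1 => hsub ⟨h0, h1⟩⟩

/-- Otherwise z could be pushed slightly away from v inside the polyhedron, placing the extreme
point z strictly inside a segment. So a vertex is determined by its active rows, which yields
finiteness and separating rows. -/
theorem eq_of_active_subset {z v : Vec p} (hz : z ∈ vertices C d) (hv : v ∈ polyhedron C d)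
    (h : ∀ i, inner ℝ (C i) z = d i → inner ℝ (C i) v = d i) : v = z := by
  obtain ⟨δ, hδ, hmem⟩ := exists_extension (mem_polyhedron_of_mem_vertices hz) h
  refine (mem_extremePoints.1 hz).2 v hv _ (hmem δ hδ le_rfl) ?_ |>.1
  have hne : (1 + δ) ≠ 0 := by positivity
  refine ⟨δ / (1 + δ), 1 / (1 + δ), by positivity, by positivity, by field_simp; ring, ?_⟩
  rw [smul_add, smul_smul, smul_sub]
  have h1 : 1 / (1 + δ) * δ = δ / (1 + δ) := by ring
  have h2 : δ / (1 + δ) = 1 - 1 / (1 + δ) := by field_simp; ring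
  rw [h1, h2]
  module

theorem finite_vertices (C : Fin m → Vec p) (d : Fin m → ℝ) : (vertices C d).Finite := by
  classical
  refine Set.Finite.of_injOn (f := fun v => Finset.univ.filter fun i => inner ℝ (C i) v = d i)
    (t := Set.univ) (fun _ _ => mem_univ _) ?_ Set.finite_univ
  intro v hv v' hv' h
  refine (eq_of_active_subset hv (mem_polyhedron_of_mem_vertices hv') fun i hi => ?_).symm
  have : i ∈ Finset.univ.filter fun i => inner ℝ (C i) v' = d i := by
    simp only at h
    rw [← h]; simpa using hi
  simpa using this

theorem nontrivial_vertices (hcompact : IsCompact (polyhedron C d))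
    (hnontrivial : (polyhedron C d).Nontrivial) : (vertices C d).Nontrivial := by
  by_contra hV
  rw [Set.not_nontrivial_iff] at hV
  have h := closure_convexHull_extremePoints hcompact (convex_polyhedron C d)
  have h2 : (closure (convexHull ℝ (vertices C d))).Subsingleton := by
    rcases hV.eq_empty_or_singleton with h | ⟨a, h⟩ <;> simp [h]
  rw [vertices, h] at h2
  exact (Set.not_subsingleton_iff.2 hnontrivial) h2

theorem exists_separating_row {v v' : Vec p} (hv : v ∈ vertices C d)
    (hv' : v' ∈ vertices C d) (hne : v' ≠ v) :
    ∃ i, inner ℝ (C i) v = d i ∧ inner ℝ (C i) v' < d i := by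
  by_contra! h
  exact hne (eq_of_active_subset hv (mem_polyhedron_of_mem_vertices hv') fun i hi =>
    le_antisymm (mem_polyhedron_of_mem_vertices hv' i) (h i hi))

theorem minSlack_le {v : Vec p} (hv : v ∈ vertices C d) {i : Fin m}
    (hi : inner ℝ (C i) v < d i) : minSlack C d ≤ d i - inner ℝ (C i) v := by
  refine csInf_le ⟨0, ?_⟩ ⟨v, hv, i, hi, rfl⟩
  rintro t ⟨v, hv, i, hi, rfl⟩
  linarith

theorem norm_le_maxRowNorm {v : Vec p} (hv : v ∈ vertices C d) {i : Fin m}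
    (hi : inner ℝ (C i) v < d i) : ‖C i‖ ≤ maxRowNorm C d := by
  refine le_csSup (Set.Finite.bddAbove ?_) ⟨i, fun h => hi.ne (h v hv), rfl⟩
  refine (Set.finite_range fun i => ‖C i‖).subset ?_
  rintro t ⟨i, -, rfl⟩
  exact ⟨i, rfl⟩

theorem minSlack_pos (hV : (vertices C d).Nontrivial) : 0 < minSlack C d := by
  obtain ⟨v, hv, v', hv', hne⟩ := hV
  obtain ⟨i, -, hi⟩ := exists_separating_row hv hv' hne.symm
  have hfin : {t | ∃ v ∈ vertices C d, ∃ i, inner ℝ (C i) v < d i ∧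
      t = d i - inner ℝ (C i) v}.Finite := by
    refine (((finite_vertices C d).prod (Set.finite_univ (α := Fin m))).image
      fun z => d z.2 - inner ℝ (C z.2) z.1).subset ?_
    rintro t ⟨v, hv, i, -, rfl⟩
    exact ⟨(v, i), ⟨hv, mem_univ _⟩, rfl⟩
  have hne' : {t | ∃ v ∈ vertices C d, ∃ i, inner ℝ (C i) v < d i ∧
      t = d i - inner ℝ (C i) v}.Nonempty := ⟨_, v', hv', i, hi, rfl⟩
  obtain ⟨v, -, i, hi, h⟩ := hne'.csInf_mem hfin
  rw [minSlack, h]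
  linarith

theorem maxRowNorm_pos (hV : (vertices C d).Nontrivial) : 0 < maxRowNorm C d := by
  obtain ⟨v, hv, v', hv', hne⟩ := hV
  obtain ⟨i, h0, hi⟩ := exists_separating_row hv hv' hne.symm
  refine lt_of_lt_of_le (norm_pos_iff.2 ?_) (norm_le_maxRowNorm hv' hi)
  intro h
  rw [h, inner_zero_left] at h0 hi
  exact hi.ne h0

theorem geomConst_pos (hV : (vertices C d).Nontrivial) : 0 < geomConst C d :=
  div_pos (minSlack_pos hV) (maxRowNorm_pos hV)

theorem diam_pos (hcompact : IsCompact (polyhedron C d))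
    (hnontrivial : (polyhedron C d).Nontrivial) : 0 < Metric.diam (polyhedron C d) := by
  obtain ⟨x, hx, y, hy, hne⟩ := hnontrivial
  exact (dist_pos.2 hne).trans_le (Metric.dist_le_diam_of_mem hcompact.isBounded hx hy)

/-- The finitely supported weights `w` on the vertices represent `x` as a convex combination. -/
structure IsRep (C : Fin m → Vec p) (d : Fin m → ℝ) (w : Vec p →₀ ℝ) (x : Vec p) : Prop where
  support_subset : ∀ v ∈ w.support, v ∈ vertices C d
  nonneg : ∀ v, 0 ≤ w v
  sum_eq : ∑ v ∈ w.support, w v = 1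
  sum_smul_eq : ∑ v ∈ w.support, w v • v = x

theorem IsRep.mem_polyhedron {w : Vec p →₀ ℝ} {x : Vec p} (h : IsRep C d w x) :
    x ∈ polyhedron C d := by
  rw [← h.sum_smul_eq]
  exact (convex_polyhedron C d).sum_mem (fun v _ => h.nonneg v) h.sum_eq
    fun v hv => mem_polyhedron_of_mem_vertices (h.support_subset v hv)

/-- To move from a convex combination `x` of vertices to a point `y` of the polytope, it suffices
to move weight proportional to `‖x - y‖` from the vertices to a single point. -/
theorem IsRep.exists_transport (hcompact : IsCompact (polyhedron C d))
    (hV : (vertices C d).Nontrivial) {w : Vec p →₀ ℝ} {x y : Vec p} (h : IsRep C d w x)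
    (hy : y ∈ polyhedron C d) :
    ∃ l : w.support → ℝ, ∃ z ∈ polyhedron C d,
      (∀ v, 0 ≤ l v ∧ l v ≤ ‖x - y‖ / geomConst C d) ∧
      x - y = ∑ v, l v • ((v : Vec p) - z) := by
  classical
  -- All ways to reach y by moving part of the weights `w` to a common target. This set is compact
  -- and contains the full transport `(w, y)`; a transport of least total mass is the one wanted.
  set S := {a : (w.support → ℝ) × Vec p | 
      a ∈ (Set.pi univ fun v : w.support => Icc 0 (w v)) ×ˢ polyhedron C d ∧
    x - y = ∑ v, a.1 v • ((v : Vec p) - a.2)} with hS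
  have hSc : IsCompact S := by
    have h1 : IsCompact ((Set.pi univ fun v : w.support => Icc 0 (w v)) ×ˢ polyhedron C d) :=
      (isCompact_univ_pi fun v => isCompact_Icc).prod hcompact
    refine h1.inter_right (isClosed_eq continuous_const ?_)
    fun_prop
  have hsum : ∀ g : Vec p → Vec p, ∑ v : w.support, g v = ∑ v ∈ w.support, g v := fun g =>
    Finset.sum_coe_sort w.support g
  have hSn : S.Nonempty := by
    refine ⟨(fun v => w v, y), ⟨fun v _ => ⟨h.nonneg _, le_rfl⟩, hy⟩, ?_⟩
    rw [hsum fun v => w v • (v - y)]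
    simp only [smul_sub, Finset.sum_sub_distrib, ← Finset.sum_smul, h.sum_eq, h.sum_smul_eq,
      one_smul]
  obtain ⟨⟨l, z⟩, ⟨⟨hl, hz⟩, hxy⟩, hmin⟩ := hSc.exists_isMinOn hSn
    (f := fun a => ∑ v, a.1 v) (by fun_prop)
  have hl0 : ∀ v, 0 ≤ l v := fun v => (hl v (mem_univ _)).1
  have hlw : ∀ v, l v ≤ w v := fun v => (hl v (mem_univ _)).2
  simp only at hxy hz
  -- If every row active at z were also active at v₀, then moving z away from v₀ would allow less
  -- mass to be taken from v₀, contradicting minimality.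
  have cover : ∀ v₀ : w.support, 0 < l v₀ →
      ∃ i, inner ℝ (C i) z = d i ∧ inner ℝ (C i) (v₀ : Vec p) < d i := by
    intro v₀ hv₀
    by_contra! hc
    have hv₀P := mem_polyhedron_of_mem_vertices (h.support_subset v₀ v₀.2)
    obtain ⟨δ, hδ, hmem⟩ := exists_extension hz (v := v₀) fun i hi =>
      le_antisymm (hv₀P i) (hc i hi)
    set t := ∑ v, l v with ht
    have htpos : 0 < t := hv₀.trans_le (Finset.single_le_sum (f := l) (fun v _ => hl0 v)
      (Finset.mem_univ v₀))
    set e := min δ (l v₀ / t) with he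
    have hepos : 0 < e := lt_min hδ (by positivity)
    have hel : t * e ≤ l v₀ := by
      have : e ≤ l v₀ / t := min_le_right _ _
      rwa [le_div_iff₀ htpos, mul_comm] at this
    -- Solves `α * (1 + e) = t * e`, the condition for the displacement to be unchanged when z moves
    -- by `e • (z - v₀)` and v₀ loses mass α; the choice of e ensures `α ≤ l v₀`.
    set α := t * e / (1 + e) with hα
    have hαpos : 0 < α := by positivity
    have hαl : α ≤ l v₀ := by
      refine le_trans (div_le_self (by positivity) ?_) hel
      linarith
    have hαe : α * (1 + e) = t * e := by rw [hα]; field_simp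
    have hnew : (Function.update l v₀ (l v₀ - α), z + e • (z - v₀)) ∈ S := by
      refine ⟨⟨fun v _ => ?_, hmem e hepos (min_le_left _ _)⟩, ?_⟩
      · by_cases hv : v = v₀
        · subst hv
          simp only [Function.update_self]
          exact ⟨by linarith, by linarith [hlw v]⟩
        · simp only [Function.update_of_ne hv]
          exact ⟨hl0 v, hlw v⟩
      · have hupd : Function.update l v₀ (l v₀ - α) = l - Pi.single v₀ α := by
          ext v
          by_cases hv : v = v₀
          · subst hv; simp
          · simp [hv]
        simp only [hupd, Pi.sub_apply, sub_smul, Finset.sum_sub_distrib]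
        have h1 : ∑ v : w.support, (Pi.single v₀ α : w.support → ℝ) v •
            ((v : Vec p) - (z + e • (z - v₀))) = α • ((v₀ : Vec p) - (z + e • (z - v₀))) := by
          rw [Finset.sum_eq_single v₀]
          · simp
          · intro b _ hb; simp [hb]
          · simp
        rw [h1, hxy]
        have h2 : ∑ v : w.support, l v • ((v : Vec p) - (z + e • (z - v₀))) =
            ∑ v : w.support, l v • ((v : Vec p) - z) - (t * e) • (z - v₀) := by
          rw [ht, Finset.sum_mul, Finset.sum_smul, ← Finset.sum_sub_distrib]
          refine Finset.sum_congr rfl fun v _ => ?_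
          module
        rw [h2, ← hαe]
        module
    have hle : ∑ v, l v ≤ ∑ v, Function.update l v₀ (l v₀ - α) v := hmin hnew
    rw [Finset.sum_update_of_mem (Finset.mem_univ v₀),
      ← Finset.add_sum_erase _ _ (Finset.mem_univ v₀), Finset.sdiff_singleton_eq_erase] at hle
    linarith
  refine ⟨l, z, hz, fun v₀ => ⟨hl0 v₀, ?_⟩, hxy⟩
  rcases (hl0 v₀).eq_or_lt with hv₀ | hv₀
  · rw [← hv₀]
    exact div_nonneg (norm_nonneg _) (geomConst_pos hV).le
  · obtain ⟨i, hiz, hiv⟩ := cover v₀ hv₀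
    have hslack := minSlack_le (h.support_subset v₀ v₀.2) hiv
    have hrow := norm_le_maxRowNorm (h.support_subset v₀ v₀.2) hiv
    -- Since row i is active at z, the displacement pairs with it to a sum of nonnegative slacks, so
    -- the term of v₀ alone is bounded by the whole.
    have h1 : inner ℝ (C i) (y - x) = ∑ v : w.support, l v * (d i - inner ℝ (C i) (v : Vec p)) := by
      rw [← neg_sub, hxy, inner_neg_right, inner_sum, ← Finset.sum_neg_distrib]
      refine Finset.sum_congr rfl fun v _ => ?_
      rw [inner_smul_right, inner_sub_right, hiz]
      ring
    have h2 : l v₀ * (d i - inner ℝ (C i) (v₀ : Vec p)) ≤ inner ℝ (C i) (y - x) := by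
      rw [h1]
      refine Finset.single_le_sum (f := fun v : w.support => l v * (d i - inner ℝ (C i) (v : Vec p)))
        (fun v _ => mul_nonneg (hl0 v) ?_) (Finset.mem_univ v₀)
      exact sub_nonneg.2 (mem_polyhedron_of_mem_vertices (h.support_subset v v.2) i)
    have h3 : inner ℝ (C i) (y - x) ≤ maxRowNorm C d * ‖x - y‖ := by
      refine (real_inner_le_norm _ _).trans ?_
      rw [norm_sub_rev]
      gcongr
    have h4 : l v₀ * minSlack C d ≤ ‖x - y‖ * maxRowNorm C d := by
      have := mul_le_mul_of_nonneg_left hslack hv₀.le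
      linarith
    rw [geomConst, div_div_eq_mul_div, le_div_iff₀ (minSlack_pos hV)]
    exact h4

/-- The pairwise gap dominates the slope of a linear functional between `x` and any point. -/
theorem IsRep.inner_sub_le (hcompact : IsCompact (polyhedron C d))
    (hV : (vertices C d).Nontrivial) {w : Vec p →₀ ℝ} {x y : Vec p} (h : IsRep C d w x)
    (hy : y ∈ polyhedron C d) {g : Vec p} {Γ : ℝ}
    (hΓ : ∀ v ∈ w.support, ∀ z ∈ polyhedron C d, inner ℝ g (v - z) ≤ Γ) :
    inner ℝ g (x - y) ≤ (vertices C d).ncard / geomConst C d * ‖x - y‖ * Γ := by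
  obtain ⟨l, z, hz, hl, hxy⟩ := h.exists_transport hcompact hV hy
  have hcard : w.support.card ≤ (vertices C d).ncard := by
    rw [← Set.ncard_coe_finset]
    exact Set.ncard_le_ncard (fun v hv => h.support_subset v hv) (finite_vertices C d)
  have hΓ0 : 0 ≤ Γ := by
    have hne : w.support.Nonempty := by
      by_contra hne
      rw [Finset.not_nonempty_iff_eq_empty] at hne
      have := h.sum_eq
      simp [hne] at this
    obtain ⟨v, hv⟩ := hne
    simpa using hΓ v hv v (mem_polyhedron_of_mem_vertices (h.support_subset v hv))
  have hG := geomConst_pos hV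
  calc inner ℝ g (x - y) = ∑ v : w.support, l v * inner ℝ g ((v : Vec p) - z) := by
        rw [hxy, inner_sum]
        simp only [inner_smul_right]
    _ ≤ ∑ v : w.support, ‖x - y‖ / geomConst C d * Γ := by
        refine Finset.sum_le_sum fun v _ => ?_
        exact (mul_le_mul_of_nonneg_left (hΓ v v.2 z hz) (hl v).1).trans
          (mul_le_mul_of_nonneg_right (hl v).2 hΓ0)
    _ = w.support.card * (‖x - y‖ / geomConst C d * Γ) := by simp
    _ ≤ (vertices C d).ncard * (‖x - y‖ / geomConst C d * Γ) := by
        gcongr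
    _ = _ := by ring

end Geometry

/-! ### Smoothness and strong convexity along lines. -/

section Smooth

variable {p : ℕ}

theorem hasDerivAt_line {f : Vec p → ℝ} (hf : Differentiable ℝ f) (x e : Vec p) (t : ℝ) :
    HasDerivAt (fun t : ℝ => f (x + t • e)) (inner ℝ (gradient f (x + t • e)) e) t := by
  have h1 : HasDerivAt (fun t : ℝ => x + t • e) e t := by
    simpa using ((hasDerivAt_id t).smul_const e).const_add x
  have h2 : HasDerivAt (fun t : ℝ => f (x + t • e)) _ t :=
    ((hf (x + t • e)).hasGradientAt.hasFDerivAt).comp_hasDerivAt t h1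
  exact h2.congr_deriv (by simp)

/-- The quadratic upper bound along a ray for a function with Lipschitz gradient. -/
theorem line_descent {f : Vec p → ℝ} (hf : Differentiable ℝ f) {K : ℝ≥0}
    (hK : LipschitzWith K (gradient f)) (x e : Vec p) {t t' : ℝ} (ht : 0 ≤ t) (htt : t ≤ t') :
    f (x + t' • e) ≤ f (x + t • e) + (t' - t) * inner ℝ (gradient f x) e +
      K / 2 * (t' ^ 2 - t ^ 2) * ‖e‖ ^ 2 := by
  -- The Lipschitz bound makes G antitone on t ≥ 0. Comparing two positive times, not only 0 and t,
  -- is what the exact line search will need.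
  set G : ℝ → ℝ := fun t => f (x + t • e) - t * inner ℝ (gradient f x) e -
    K / 2 * t ^ 2 * ‖e‖ ^ 2 with hG
  have hder : ∀ t, HasDerivAt G (inner ℝ (gradient f (x + t • e)) e -
      inner ℝ (gradient f x) e - K * t * ‖e‖ ^ 2) t := by
    intro t
    have h1 := (hasDerivAt_id t).mul_const (inner ℝ (gradient f x) e)
    have h2 := (((hasDerivAt_id t).pow 2).const_mul ((K : ℝ) / 2)).mul_const (‖e‖ ^ 2)
    have h3 := ((hasDerivAt_line hf x e t).sub h1).sub h2
    refine h3.congr_deriv ?_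
    push_cast
    simp only [id_eq]
    ring
  have hanti : AntitoneOn G (Ici 0) := by
    refine antitoneOn_of_deriv_nonpos (convex_Ici 0)
      (fun t _ => (hder t).continuousAt.continuousWithinAt)
      (fun t _ => (hder t).differentiableAt.differentiableWithinAt) fun t ht => ?_
    rw [interior_Ici, mem_Ioi] at ht
    rw [(hder t).deriv, ← inner_sub_left]
    have h1 := real_inner_le_norm (gradient f (x + t • e) - gradient f x) e
    have h2 := hK.dist_le_mul (x + t • e) x
    rw [dist_eq_norm, dist_eq_norm, add_sub_cancel_left, norm_smul, Real.norm_of_nonneg ht.le] at h2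
    have h3 := mul_le_mul_of_nonneg_right h2 (norm_nonneg e)
    nlinarith
  have := hanti (mem_Ici.2 ht) (mem_Ici.2 (ht.trans htt)) htt
  simp only [hG] at this
  linarith

/-- The first-order lower bound for strongly convex functions. -/
theorem sub_le_of_strongConvexOn {f : Vec p → ℝ} (hf : Differentiable ℝ f) {σ : ℝ}
    (hσ : StrongConvexOn Set.univ σ f) (x y : Vec p) :
    f x - f y ≤ inner ℝ (gradient f x) (x - y) - σ / 2 * ‖x - y‖ ^ 2 := by
  have hd := hasDerivAt_line hf x (y - x) 0
  rw [zero_smul, add_zero] at hd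
  have h1 := hd.tendsto_slope_zero_right
  have h2 : Tendsto (fun t : ℝ => f y - f x - (1 - t) * (σ / 2 * ‖x - y‖ ^ 2)) (𝓝[>] 0)
      (𝓝 (f y - f x - (1 - 0) * (σ / 2 * ‖x - y‖ ^ 2))) := by
    have : Continuous fun t : ℝ => f y - f x - (1 - t) * (σ / 2 * ‖x - y‖ ^ 2) := by fun_prop
    exact (this.tendsto 0).mono_left nhdsWithin_le_nhds
  have h3 : ∀ᶠ t in 𝓝[>] (0 : ℝ), t⁻¹ • (f (x + (0 + t) • (y - x)) - f (x + (0 : ℝ) • (y - x))) ≤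
      f y - f x - (1 - t) * (σ / 2 * ‖x - y‖ ^ 2) := by
    filter_upwards [Ioc_mem_nhdsGT (zero_lt_one (α := ℝ))] with t ht
    have h4 := hσ.2 (mem_univ x) (mem_univ y) (sub_nonneg.2 ht.2) ht.1.le (by ring)
    have h5 : (1 - t) • x + t • y = x + (0 + t) • (y - x) := by module
    rw [h5] at h4
    simp only [smul_eq_mul, zero_smul, add_zero] at h4 ⊢
    rw [inv_mul_le_iff₀ ht.1]
    linarith
  have h6 := le_of_tendsto_of_tendsto h1 h2 h3
  have h7 : inner ℝ (gradient f x) (y - x) = -inner ℝ (gradient f x) (x - y) := by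
    rw [← inner_neg_right, neg_sub]
  linarith

/-- With K = 0 the gradient is constant, and adding the first-order inequalities at two distinct
points contradicts σ > 0. This keeps the denominators in the step size and in `kappa` from
vanishing. -/
theorem lipschitz_pos_of_strongConvexOn [Nontrivial (Vec p)] {f : Vec p → ℝ}
    (hf : Differentiable ℝ f) {σ : ℝ} (hσ0 : 0 < σ) (hσ : StrongConvexOn Set.univ σ f) {K : ℝ≥0}
    (hK : LipschitzWith K (gradient f)) : 0 < K := by
  obtain ⟨x, y, hne⟩ := exists_pair_ne (Vec p)
  rw [pos_iff_ne_zero]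
  rintro rfl
  have h1 := sub_le_of_strongConvexOn hf hσ x y
  have h2 := sub_le_of_strongConvexOn hf hσ y x
  have h3 := hK.dist_le_mul x y
  simp only [NNReal.coe_zero, zero_mul] at h3
  rw [dist_le_zero.1 h3, norm_sub_rev, ← neg_sub y x, inner_neg_right] at h1
  have h4 : 0 < ‖y - x‖ ^ 2 := by
    have := norm_pos_iff.2 (sub_ne_zero.2 hne.symm)
    positivity
  have h5 := mul_pos hσ0 h4
  linarith

end Smooth

/-! ### Sampling error in terms of empirical frequencies. -/

section Sample

variable {p m n : ℕ}

/-- The frequency of the index `i` among the samples `s 0, …, s (M - 1)`. -/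
def freq (M : ℕ) (s : ℕ → Fin n) (i : Fin n) : ℝ :=
  (∑ j ∈ Finset.range M, if s j = i then 1 else 0) / M

/-- The total deviation of the sampled frequencies from the uniform distribution. -/
def deviation (M : ℕ) (s : ℕ → Fin n) : ℝ :=
  ∑ i, |freq M s i - (n : ℝ)⁻¹|

/-- The gradient of the objective. -/
def meanGradient (f : Fin n → Vec p → ℝ) (x : Vec p) : Vec p :=
  (n : ℝ)⁻¹ • ∑ i, gradient (f i) x

theorem deviation_nonneg (M : ℕ) (s : ℕ → Fin n) : 0 ≤ deviation M s :=
  Finset.sum_nonneg fun _ _ => abs_nonneg _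

theorem freq_mem_Icc (M : ℕ) (s : ℕ → Fin n) (i : Fin n) : freq M s i ∈ Icc (0 : ℝ) 1 := by
  refine ⟨div_nonneg (Finset.sum_nonneg fun j _ => by split_ifs <;> simp) (Nat.cast_nonneg _),
    div_le_one_of_le₀ ?_ (Nat.cast_nonneg _)⟩
  calc (∑ j ∈ Finset.range M, if s j = i then (1 : ℝ) else 0) ≤ ∑ j ∈ Finset.range M, 1 :=
        Finset.sum_le_sum fun j _ => by split_ifs <;> simp
    _ = M := by simp

theorem deviation_le (hn : 0 < n) (M : ℕ) (s : ℕ → Fin n) : deviation M s ≤ n := by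
  calc deviation M s ≤ ∑ i : Fin n, 1 := by
        refine Finset.sum_le_sum fun i _ => ?_
        have h := freq_mem_Icc M s i
        have h1 : (1 : ℝ) ≤ n := by exact_mod_cast hn
        have h2 : (n : ℝ)⁻¹ ≤ 1 := inv_le_one_of_one_le₀ h1
        have h3 : 0 ≤ (n : ℝ)⁻¹ := by positivity
        rw [abs_le]
        constructor <;> linarith [h.1, h.2]
    _ = n := by simp

/-- Grouping equal samples separates the randomness (the frequencies) from the sampled quantity, so
one `deviation` serves objectives and gradients at all points. -/
theorem inv_smul_sum_sample {E : Type*} [AddCommGroup E] [Module ℝ E] (M : ℕ) (s : ℕ → Fin n)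
    (g : Fin n → E) : (M : ℝ)⁻¹ • ∑ j ∈ Finset.range M, g (s j) = ∑ i, freq M s i • g i := by
  have h : ∀ i, freq M s i • g i =
      (M : ℝ)⁻¹ • ∑ j ∈ Finset.range M, (if s j = i then g i else 0) := by
    intro i
    rw [freq, div_eq_inv_mul, mul_smul, Finset.sum_smul]
    simp only [ite_smul, one_smul, zero_smul]
  simp only [h]
  rw [← Finset.smul_sum, Finset.sum_comm]
  simp

theorem norm_sample_sub_mean_le {E : Type*} [NormedAddCommGroup E] [NormedSpace ℝ E] (M : ℕ)
    (s : ℕ → Fin n) (g : Fin n → E) {B : ℝ} (hB : ∀ i, ‖g i‖ ≤ B) :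
    ‖(M : ℝ)⁻¹ • ∑ j ∈ Finset.range M, g (s j) - (n : ℝ)⁻¹ • ∑ i, g i‖ ≤ B * deviation M s := by
  rw [inv_smul_sum_sample, Finset.smul_sum, ← Finset.sum_sub_distrib, deviation, Finset.mul_sum]
  refine (norm_sum_le _ _).trans (Finset.sum_le_sum fun i _ => ?_)
  rw [← sub_smul, norm_smul, Real.norm_eq_abs, mul_comm]
  exact mul_le_mul_of_nonneg_right (hB i) (abs_nonneg _)

theorem abs_sampleObjective_sub_le (f : Fin n → Vec p → ℝ) (M : ℕ) (s : ℕ → Fin n) (x : Vec p)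
    {B : ℝ} (hB : ∀ i, |f i x| ≤ B) :
    |sampleObjective f M s x - objective f x| ≤ B * deviation M s := by
  have := norm_sample_sub_mean_le M s (fun i => f i x) hB
  rwa [Real.norm_eq_abs, smul_eq_mul, smul_eq_mul, inv_mul_eq_div, inv_mul_eq_div] at this

theorem norm_sampleGradient_sub_le (f : Fin n → Vec p → ℝ) (M : ℕ) (s : ℕ → Fin n) (x : Vec p)
    {B : ℝ} (hB : ∀ i, ‖gradient (f i) x‖ ≤ B) :
    ‖sampleGradient f M s x - meanGradient f x‖ ≤ B * deviation M s :=
  norm_sample_sub_mean_le M s (fun i => gradient (f i) x) hB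

theorem objective_sub_le (hn : 0 < n) {f : Fin n → Vec p → ℝ} (hf : ∀ i, Differentiable ℝ (f i))
    {σ : Fin n → ℝ} (hσ : ∀ i, StrongConvexOn Set.univ (σ i) (f i)) {σ₀ : ℝ} (hσ₀ : ∀ i, σ₀ ≤ σ i)
    (x y : Vec p) : objective f x - objective f y ≤
      inner ℝ (meanGradient f x) (x - y) - σ₀ / 2 * ‖x - y‖ ^ 2 := by
  have hn' : (0 : ℝ) < n := by exact_mod_cast hn
  have h : ∑ i, (f i x - f i y) ≤
      ∑ i, (inner ℝ (gradient (f i) x) (x - y) - σ₀ / 2 * ‖x - y‖ ^ 2) := by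
    refine Finset.sum_le_sum fun i _ => (sub_le_of_strongConvexOn (hf i) (hσ i) x y).trans ?_
    have := hσ₀ i
    gcongr
  rw [objective, objective, ← sub_div, ← Finset.sum_sub_distrib, div_le_iff₀ hn', meanGradient,
    real_inner_smul_left, sum_inner]
  refine h.trans_eq ?_
  rw [Finset.sum_sub_distrib]
  simp
  field_simp

theorem norm_meanGradient_sub_le {f : Fin n → Vec p → ℝ} {L : Fin n → ℝ≥0}
    (hL : ∀ i, LipschitzWith (L i) (gradient (f i))) (hn : 0 < n) {K : ℝ} (hK : ∀ i, L i ≤ K)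
    (x y : Vec p) : ‖meanGradient f x - meanGradient f y‖ ≤ K * ‖x - y‖ := by
  have hn' : (0 : ℝ) < n := by exact_mod_cast hn
  rw [meanGradient, meanGradient, ← smul_sub, ← Finset.sum_sub_distrib, norm_smul, norm_inv,
    Real.norm_natCast, inv_mul_le_iff₀ hn']
  calc ‖∑ i, (gradient (f i) x - gradient (f i) y)‖ ≤ ∑ i : Fin n, K * ‖x - y‖ := by
        refine (norm_sum_le _ _).trans (Finset.sum_le_sum fun i _ => ?_)
        have := (hL i).dist_le_mul x y
        rw [dist_eq_norm, dist_eq_norm] at this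
        exact this.trans (mul_le_mul_of_nonneg_right (hK i) (norm_nonneg _))
    _ = _ := by simp

theorem sampleObjective_line_descent {f : Fin n → Vec p → ℝ} (hf : ∀ i, Differentiable ℝ (f i))
    {L : Fin n → ℝ≥0} (hL : ∀ i, LipschitzWith (L i) (gradient (f i))) (M : ℕ) (s : ℕ → Fin n)
    (x e : Vec p) {t t' : ℝ} (ht : 0 ≤ t) (htt : t ≤ t') :
    sampleObjective f M s (x + t' • e) ≤ sampleObjective f M s (x + t • e) +
      (t' - t) * inner ℝ (sampleGradient f M s x) e +
      sampleLipschitz L M s / 2 * (t' ^ 2 - t ^ 2) * ‖e‖ ^ 2 := by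
  have h := Finset.sum_le_sum fun j (_ : j ∈ Finset.range M) =>
    line_descent (hf (s j)) (hL (s j)) x e ht htt
  have h2 := div_le_div_of_nonneg_right h (Nat.cast_nonneg (α := ℝ) M)
  refine h2.trans_eq ?_
  simp only [Finset.sum_add_distrib, ← Finset.mul_sum, ← Finset.sum_mul, ← Finset.sum_div]
  rw [sampleObjective, sampleGradient, real_inner_smul_left, sum_inner, sampleLipschitz]
  ring

theorem sampleLipschitz_le {L : Fin n → ℝ≥0} {K : ℝ} (hK : ∀ i, L i ≤ K) {M : ℕ} (hM : 0 < M)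
    (s : ℕ → Fin n) : sampleLipschitz L M s ≤ K := by
  have hM' : (0 : ℝ) < M := by exact_mod_cast hM
  rw [sampleLipschitz, div_le_iff₀ hM']
  calc _ ≤ ∑ j ∈ Finset.range M, K := Finset.sum_le_sum fun j _ => hK (s j)
    _ = K * M := by simp [mul_comm]

theorem sampleLipschitz_pos {L : Fin n → ℝ≥0} (hL : ∀ i, 0 < L i) {M : ℕ} (hM : 0 < M)
    (s : ℕ → Fin n) : 0 < sampleLipschitz L M s := by
  have hM' : (0 : ℝ) < M := by exact_mod_cast hM
  exact div_pos (Finset.sum_pos (fun j _ => NNReal.coe_pos.2 (hL (s j)))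
    (Finset.nonempty_range_iff.2 hM.ne')) hM'

end Sample

/-! ### One iteration: sufficient decrease or removal of a vertex. -/

section Step

variable {p m n : ℕ}

/-- Both step size rules decrease the sampled objective; unless the decrease is substantial,
the step is maximal and short. -/
theorem IsStepSize.decrease {f : Fin n → Vec p → ℝ} (hf : ∀ i, Differentiable ℝ (f i))
    {L : Fin n → ℝ≥0} (hL : ∀ i, LipschitzWith (L i) (gradient (f i))) (hLpos : ∀ i, 0 < L i)
    {K : ℝ} (hK : ∀ i, L i ≤ K) {M : ℕ} (hM : 0 < M) {s : ℕ → Fin n} {x e : Vec p} {D : ℝ}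
    (he : ‖e‖ ≤ D) {γmax γ : ℝ} (hγmax : 0 ≤ γmax)
    (hg : inner ℝ (sampleGradient f M s x) e ≤ 0) (h : IsStepSize f L M s x e γmax γ) :
    γ ∈ Icc 0 γmax ∧ sampleObjective f M s (x + γ • e) ≤ sampleObjective f M s x ∧
      ∀ τ, 0 ≤ τ → K * D ^ 2 * τ < -inner ℝ (sampleGradient f M s x) e →
        sampleObjective f M s (x + γ • e) ≤
            sampleObjective f M s x - τ / 2 * -inner ℝ (sampleGradient f M s x) e ∨
          (γmax ≤ τ ∧ γ = γmax) := by
  set Γ : ℝ := -inner ℝ (sampleGradient f M s x) e with hΓ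
  set Q : ℝ := sampleLipschitz L M s * ‖e‖ ^ 2 with hQ
  have hΓ0 : 0 ≤ Γ := by linarith
  have hLk := sampleLipschitz_pos hLpos hM s
  have hQ0 : 0 ≤ Q := by positivity
  have hQK : Q ≤ K * D ^ 2 := by
    have := sampleLipschitz_le hK hM s
    rw [hQ]
    gcongr
    linarith
  have hdesc : ∀ t t', 0 ≤ t → t ≤ t' → sampleObjective f M s (x + t' • e) ≤
      sampleObjective f M s (x + t • e) - (t' - t) * (Γ - Q / 2 * (t' + t)) := by
    intro t t' ht htt
    refine (sampleObjective_line_descent hf hL M s x e ht htt).trans_eq ?_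
    rw [hΓ, hQ]
    ring
  have hdesc0 : ∀ t, 0 ≤ t → Q * t ≤ Γ → sampleObjective f M s (x + t • e) ≤
      sampleObjective f M s x - t / 2 * Γ := by
    intro t ht hQt
    have h0 := hdesc 0 t le_rfl ht
    rw [zero_smul, add_zero] at h0
    have := mul_le_mul_of_nonneg_left hQt ht
    linarith
  rcases h with h | ⟨h, hmin⟩
  · have hγ0 : 0 ≤ γ := by
      rw [h]
      exact le_min (div_nonneg hΓ0 hQ0) hγmax
    have hQγ : Q * γ ≤ Γ := by
      rcases hQ0.eq_or_lt with h0 | h0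
      · rw [← h0, zero_mul]; exact hΓ0
      · have : γ ≤ Γ / Q := by rw [h]; exact min_le_left _ _
        rw [le_div_iff₀ h0] at this
        linarith
    refine ⟨⟨hγ0, by rw [h]; exact min_le_right _ _⟩, ?_, ?_⟩
    · have := hdesc0 γ hγ0 hQγ
      have : 0 ≤ γ / 2 * Γ := by positivity
      linarith
    · intro τ hτ hτΓ
      have hQτ : Q * τ < Γ := (mul_le_mul_of_nonneg_right hQK hτ).trans_lt hτΓ
      -- If Q = 0 then e = 0 and Γ = 0, against the strict bound; so the quotient Γ / Q is not a
      -- default value.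
      have hQpos : 0 < Q := by
        refine hQ0.lt_of_ne fun h0 => ?_
        have he0 : ‖e‖ ^ 2 = 0 := by
          rcases mul_eq_zero.1 h0.symm with h1 | h1
          · exact absurd h1 hLk.ne'
          · exact h1
        rw [sq_eq_zero_iff, norm_eq_zero] at he0
        rw [← h0, zero_mul, hΓ, he0, inner_zero_right, neg_zero] at hQτ
        exact lt_irrefl _ hQτ
      have hτQ : τ ≤ Γ / Q := by
        rw [le_div_iff₀ hQpos]
        linarith
      rcases le_total γmax τ with h1 | h1
      · right
        refine ⟨h1, ?_⟩
        rw [h]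
        exact min_eq_right (h1.trans hτQ)
      · left
        refine (hdesc0 γ hγ0 hQγ).trans ?_
        have : τ ≤ γ := by
          rw [h]
          exact le_min hτQ h1
        gcongr
  · refine ⟨h, ?_, ?_⟩
    · have : sampleObjective f M s (x + γ • e) ≤ sampleObjective f M s (x + (0 : ℝ) • e) :=
        hmin ⟨le_rfl, hγmax⟩
      simpa using this
    · intro τ hτ hτΓ
      have hQτ : Q * τ < Γ := (mul_le_mul_of_nonneg_right hQK hτ).trans_lt hτΓ
      rcases le_total γmax τ with h1 | h1
      · right
        -- On this short interval the upper model still decreases strictly, so a minimizer short of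
        -- `γmax` would be beaten by the endpoint.
        refine ⟨h1, h.2.eq_or_lt.resolve_right fun hlt => ?_⟩
        have h2 : sampleObjective f M s (x + γ • e) ≤ sampleObjective f M s (x + γmax • e) :=
          hmin ⟨hγmax, le_rfl⟩
        have h3 := hdesc γ γmax h.1 h.2
        have h4 : Q / 2 * (γmax + γ) < Γ := by
          have : Q / 2 * (γmax + γ) ≤ Q / 2 * (τ + τ) := by
            gcongr
            exact h.2.trans h1
          linarith
        have := mul_pos (sub_pos.2 hlt) (sub_pos.2 h4)
        linarith
      · left
        have h2 : sampleObjective f M s (x + γ • e) ≤ sampleObjective f M s (x + τ • e) :=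
          hmin ⟨hτ, h1⟩
        exact h2.trans (hdesc0 τ hτ hQτ.le)

theorem IsRep.single {C : Fin m → Vec p} {d : Fin m → ℝ} {v : Vec p} (hv : v ∈ vertices C d) :
    IsRep C d (Finsupp.single v 1) v := by
  refine ⟨?_, ?_, ?_, ?_⟩
  · intro a ha
    rw [Finset.mem_singleton.1 (Finsupp.support_single_subset ha)]
    exact hv
  · intro a
    rw [Finsupp.single_apply]
    split_ifs <;> simp
  · simp
  · simp

/-- Moving weight from one vertex to another. -/
theorem IsRep.move {C : Fin m → Vec p} {d : Fin m → ℝ} {w : Vec p →₀ ℝ} {x q u : Vec p}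
    (h : IsRep C d w x) (hq : q ∈ vertices C d) {γ : ℝ} (hu : u ∈ w.support)
    (hγ : γ ∈ Icc 0 (w u)) :
    IsRep C d (w + Finsupp.single q γ - Finsupp.single u γ) (x + γ • (q - u)) ∧
      ∀ v ∈ (w + Finsupp.single q γ - Finsupp.single u γ).support, v = q ∨ v ∈ w.support := by
  have hsupp : ∀ v ∈ (w + Finsupp.single q γ - Finsupp.single u γ).support,
      v = q ∨ v ∈ w.support := by
    intro v hv
    by_contra! hne
    have hvu : v ≠ u := fun h => hne.2 (h ▸ hu)
    rw [Finsupp.mem_support_iff] at hv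
    apply hv
    simp [Finsupp.notMem_support_iff.1 hne.2, hne.1, hvu]
  refine ⟨⟨?_, ?_, ?_, ?_⟩, hsupp⟩
  · intro v hv
    rcases hsupp v hv with rfl | hv
    · exact hq
    · exact h.support_subset v hv
  · intro v
    rw [Finsupp.sub_apply, Finsupp.add_apply]
    have h1 := h.nonneg v
    have h2 : 0 ≤ Finsupp.single q γ v := by
      rw [Finsupp.single_apply]
      split_ifs
      exacts [hγ.1, le_rfl]
    have h3 : Finsupp.single u γ v ≤ w v := by
      rw [Finsupp.single_apply]
      split_ifs with huv
      · rw [← huv]; exact hγ.2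
      · exact h1
    linarith
  -- Linear in w, although the support over which the sum runs changes with the move.
  · have hlin : ∀ w : Vec p →₀ ℝ, ∑ v ∈ w.support, w v =
        Finsupp.linearCombination ℝ (fun _ : Vec p => (1 : ℝ)) w := by
      intro w
      simp [Finsupp.linearCombination_apply, Finsupp.sum]
    have h1 := h.sum_eq
    rw [hlin] at h1 ⊢
    rw [map_sub, map_add, h1]
    simp
  · have hlin : ∀ w : Vec p →₀ ℝ, ∑ v ∈ w.support, w v • v =
        Finsupp.linearCombination ℝ (fun v : Vec p => v) w := by
      intro w
      simp [Finsupp.linearCombination_apply, Finsupp.sum]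
    have h1 := h.sum_smul_eq
    rw [hlin] at h1 ⊢
    rw [map_sub, map_add, h1]
    simp only [Finsupp.linearCombination_single]
    module

/-- A maximal step takes all the weight of u. The Carathéodory reduction only shrinks the support,
so in both variants u stays removed and no vertex but q can enter. -/
theorem IsStep.dichotomy {C : Fin m → Vec p} {d : Fin m → ℝ}
    {f : Fin n → Vec p → ℝ} (hf : ∀ i, Differentiable ℝ (f i))
    {L : Fin n → ℝ≥0} (hL : ∀ i, LipschitzWith (L i) (gradient (f i))) (hLpos : ∀ i, 0 < L i)
    {K : ℝ} (hK : ∀ i, L i ≤ K) {D : ℝ}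
    (hD : ∀ x ∈ polyhedron C d, ∀ y ∈ polyhedron C d, ‖x - y‖ ≤ D) {carath : Bool}
    {M : ℕ} (hM : 0 < M) {s : ℕ → Fin n} {x x' : Vec p} {w w' : Vec p →₀ ℝ}
    (hrep : IsRep C d w x) (h : IsStep C d f L carath M s x w x' w') :
    IsRep C d w' x' ∧ sampleObjective f M s x' ≤ sampleObjective f M s x ∧
      ∃ q ∈ vertices C d, ∃ u ∈ w.support,
        (∀ y ∈ polyhedron C d,
          inner ℝ (sampleGradient f M s x) q ≤ inner ℝ (sampleGradient f M s x) y) ∧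
        (∀ v ∈ w.support,
          inner ℝ (sampleGradient f M s x) v ≤ inner ℝ (sampleGradient f M s x) u) ∧
        (∀ v ∈ w'.support, v = q ∨ v ∈ w.support) ∧
        ∀ τ, 0 ≤ τ → K * D ^ 2 * τ < inner ℝ (sampleGradient f M s x) (u - q) →
          sampleObjective f M s x' ≤
            sampleObjective f M s x - τ / 2 * inner ℝ (sampleGradient f M s x) (u - q) ∨
          (‖x' - x‖ ≤ τ * D ∧ u ∉ w'.support) := by
  obtain ⟨q, u, γ, hq, hqmin, hu, humax, hstep, hx', hw'⟩ := h
  have huV := hrep.support_subset u hu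
  have huP := mem_polyhedron_of_mem_vertices huV
  have hqP := mem_polyhedron_of_mem_vertices hq
  have hneg : -inner ℝ (sampleGradient f M s x) (q - u) =
      (inner ℝ (sampleGradient f M s x) (u - q) : ℝ) := by
    rw [← inner_neg_right, neg_sub]
  have hg : inner ℝ (sampleGradient f M s x) (q - u) ≤ (0 : ℝ) := by
    rw [inner_sub_right]
    linarith [hqmin u huP]
  obtain ⟨hγ, hdec, hτ⟩ := hstep.decrease hf hL hLpos hK hM (hD q hqP u huP) (hrep.nonneg u) hg
  obtain ⟨hrep', hsupp⟩ := hrep.move hq hu hγ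
  rw [← hx'] at hrep' hdec hτ
  simp only [hneg] at hτ
  have hD0 : 0 ≤ D := (norm_nonneg _).trans (hD q hqP u huP)
  have hsub : IsRep C d w' x' ∧
      w'.support ⊆ (w + Finsupp.single q γ - Finsupp.single u γ).support := by
    cases carath with
    | true =>
      simp only [if_true] at hw'
      obtain ⟨h1, -, h2, h3, h4⟩ := hw'
      exact ⟨⟨fun v hv => hrep'.support_subset v (h1 hv), h2, h3, h4⟩, h1⟩
    | false =>
      simp only [Bool.false_eq_true, if_false] at hw'
      rw [hw']
      exact ⟨hrep', subset_rfl⟩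
  refine ⟨hsub.1, hdec, q, hq, u, hu, hqmin, humax, fun v hv => hsupp v (hsub.2 hv), ?_⟩
  intro τ hτ0 hτΓ
  refine (hτ τ hτ0 hτΓ).imp_right fun ⟨h1, h2⟩ => ⟨?_, fun hmem => ?_⟩
  · rw [hx', add_sub_cancel_left, norm_smul, Real.norm_of_nonneg hγ.1]
    have := hD q hqP u huP
    have h3 : γ ≤ τ := h2.trans_le h1
    gcongr
  · have hK0 : 0 ≤ K * D ^ 2 * τ := by
      obtain ⟨i⟩ : Nonempty (Fin n) := ⟨s 0⟩
      have : 0 ≤ K := (L i).coe_nonneg.trans (hK i)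
      positivity
    -- Otherwise the weight taken from u would be returned to it.
    have hqu : q ≠ u := by
      rintro rfl
      rw [sub_self, inner_zero_right] at hτΓ
      linarith
    have := Finsupp.mem_support_iff.1 (hsub.2 hmem)
    apply this
    simp [hqu.symm, h2]

end Step

/-- If the gradients `g j` hardly change, then a vertex `u j` that was removed never reenters,
because only minimizers `q j` enter; thus the number of removals is bounded. -/
theorem exists_vertex_repeat {E : Type*} [NormedAddCommGroup E] [InnerProductSpace ℝ E]
    {V : Finset E} {T : ℕ} (hT : V.card < T) {S : ℕ → Finset E} {u q g : ℕ → E} {a : ℝ}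
    (huV : ∀ j < T, u j ∈ V) (huS : ∀ j < T, u j ∈ S j) (huS' : ∀ j < T, u j ∉ S (j + 1))
    (hS : ∀ j < T, ∀ v ∈ S (j + 1), v = q j ∨ v ∈ S j)
    (hq : ∀ i < T, ∀ j < T, inner ℝ (g i) (q i) ≤ inner ℝ (g i) (q j))
    (ha : ∀ j < T, a ≤ inner ℝ (g j) (u j - q j)) :
    ∃ i < T, ∃ j < T, a ≤ inner ℝ (g j - g i) (u j - q j) := by
  by_contra! hsmall
  -- If `u j = q l`, then `g l` pairs nonpositively with `u j - q j` because `q l` is minimal for `g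
  -- l`, whereas `g j` pairs to at least a; the difference of gradients would then be too large.
  have hne : ∀ j < T, ∀ l < j, u j ≠ q l := by
    intro j hj l hl h
    have h1 := ha j hj
    have h2 := hsmall l (hl.trans hj) j hj
    have h3 := hq l (hl.trans hj) j hj
    rw [inner_sub_left] at h2
    rw [h, inner_sub_right (g l)] at h2
    rw [h] at h1
    linarith
  have hinj : ∀ i j, i < j → j < T → u i ≠ u j := by
    intro i j hij hj h
    have : ∀ l, i + 1 ≤ l → l ≤ j → u i ∉ S l := by
      intro l hl
      induction l, hl using Nat.le_induction with
      | base => exact fun _ => huS' i (hij.trans hj)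
      | succ l hl ih =>
        intro hlj hmem
        rcases hS l (by omega) _ hmem with h1 | h1
        · exact hne j hj l (by omega) (h ▸ h1)
        · exact ih (by omega) h1
    exact this j hij le_rfl (h ▸ huS j hj)
  have hcard : (Finset.range T).card ≤ V.card := by
    refine Finset.card_le_card_of_injOn u (fun j hj => huV j (Finset.mem_range.1 hj)) ?_
    intro i hi j hj h
    simp only [Finset.coe_range, mem_Iio] at hi hj
    rcases lt_trichotomy i j with hij | hij | hij
    · exact absurd h (hinj i j hij hj)
    · exact hij
    · exact absurd h.symm (hinj j i hij hi)
  rw [Finset.card_range] at hcard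
  omega

/-! ### Contraction of the optimality gap over a window of iterations. -/

section Contraction

variable {p m n : ℕ}

theorem continuous_objective {f : Fin n → Vec p → ℝ} (hf : ∀ i, Differentiable ℝ (f i)) :
    Continuous (objective f) := by
  have := fun i => (hf i).continuous
  unfold objective
  fun_prop

theorem exists_eq_optValue {C : Fin m → Vec p} {d : Fin m → ℝ}
    (hcompact : IsCompact (polyhedron C d)) (hne : (polyhedron C d).Nonempty)
    {f : Fin n → Vec p → ℝ} (hf : ∀ i, Differentiable ℝ (f i)) :
    ∃ y ∈ polyhedron C d, objective f y = optValue C d f := by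
  have := (hcompact.image (continuous_objective hf)).sInf_mem (hne.image _)
  obtain ⟨y, hy, h⟩ := this
  exact ⟨y, hy, h⟩

theorem optValue_le {C : Fin m → Vec p} {d : Fin m → ℝ}
    (hcompact : IsCompact (polyhedron C d))
    {f : Fin n → Vec p → ℝ} (hf : ∀ i, Differentiable ℝ (f i)) {x : Vec p}
    (hx : x ∈ polyhedron C d) : optValue C d f ≤ objective f x :=
  csInf_le (hcompact.image (continuous_objective hf)).bddBelow ⟨x, hx, rfl⟩

theorem exists_uniform_bound {C : Fin m → Vec p} {d : Fin m → ℝ}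
    (hcompact : IsCompact (polyhedron C d)) {f : Fin n → Vec p → ℝ}
    (hf : ∀ i, Differentiable ℝ (f i)) {L : Fin n → ℝ≥0}
    (hL : ∀ i, LipschitzWith (L i) (gradient (f i))) :
    ∃ B : ℝ, 0 < B ∧ ∀ x ∈ polyhedron C d, ∀ i, |f i x| ≤ B ∧ ‖gradient (f i) x‖ ≤ B := by
  have h : ∀ i, ∃ B : ℝ, ∀ x ∈ polyhedron C d, |f i x| + ‖gradient (f i) x‖ ≤ B := by
    intro i
    have h1 := (hf i).continuous
    have h2 := (hL i).continuous
    obtain ⟨B, hB⟩ := hcompact.exists_bound_of_continuousOn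
      (f := fun x => |f i x| + ‖gradient (f i) x‖) (by fun_prop)
    exact ⟨B, fun x hx => (le_abs_self _).trans (hB x hx)⟩
  choose B hB using h
  refine ⟨1 + ∑ i, |B i|, by positivity, fun x hx i => ?_⟩
  have h1 := hB i x hx
  have h2 := Finset.single_le_sum (f := fun i => |B i|) (fun i _ => abs_nonneg _)
    (Finset.mem_univ i)
  have h3 := le_abs_self (B i)
  have h4 := abs_nonneg (f i x)
  have h5 := norm_nonneg (gradient (f i) x)
  constructor <;> linarith

/-- The optimality gap is controlled by the pairwise gap of the sampled gradient. -/
theorem IsRep.optimality_gap_le (hn : 0 < n) {C : Fin m → Vec p} {d : Fin m → ℝ}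
    (hcompact : IsCompact (polyhedron C d)) (hV : (vertices C d).Nontrivial)
    {f : Fin n → Vec p → ℝ} (hf : ∀ i, Differentiable ℝ (f i))
    {σ : Fin n → ℝ} (hσ : ∀ i, StrongConvexOn Set.univ (σ i) (f i)) {σ₀ : ℝ} (hσ₀ : ∀ i, σ₀ ≤ σ i)
    {w : Vec p →₀ ℝ} {x : Vec p} (h : IsRep C d w x) {B : ℝ}
    (hB : ∀ i, ‖gradient (f i) x‖ ≤ B) (M : ℕ) (s : ℕ → Fin n) {q u : Vec p}
    (hq : ∀ y ∈ polyhedron C d,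
      inner ℝ (sampleGradient f M s x) q ≤ inner ℝ (sampleGradient f M s x) y)
    (hu : ∀ v ∈ w.support,
      inner ℝ (sampleGradient f M s x) v ≤ inner ℝ (sampleGradient f M s x) u) :
    2 * σ₀ * (objective f x - optValue C d f) ≤
      ((vertices C d).ncard / geomConst C d * inner ℝ (sampleGradient f M s x) (u - q) +
        B * deviation M s) ^ 2 := by
  obtain ⟨y, hy, hopt⟩ := exists_eq_optValue hcompact ⟨x, h.mem_polyhedron⟩ hf
  rw [← hopt]
  set R : ℝ := (vertices C d).ncard / geomConst C d
  set Γ : ℝ := inner ℝ (sampleGradient f M s x) (u - q) with hΓ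
  have h1 := objective_sub_le hn hf hσ hσ₀ x y
  have h2 : inner ℝ (sampleGradient f M s x) (x - y) ≤ R * ‖x - y‖ * Γ := by
    refine h.inner_sub_le hcompact hV hy fun v hv z hz => ?_
    rw [hΓ, inner_sub_right, inner_sub_right]
    exact sub_le_sub (hu v hv) (hq z hz)
  have h3 : inner ℝ (meanGradient f x - sampleGradient f M s x) (x - y) ≤
      B * deviation M s * ‖x - y‖ := by
    refine (real_inner_le_norm _ _).trans ?_
    rw [norm_sub_rev]
    exact mul_le_mul_of_nonneg_right (norm_sampleGradient_sub_le f M s x hB) (norm_nonneg _)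
  rw [inner_sub_left] at h3
  set r := ‖x - y‖
  rcases le_or_gt σ₀ 0 with hs | hs
  · have h4 : 0 ≤ objective f x - objective f y := by
      rw [hopt]
      exact sub_nonneg.2 (optValue_le hcompact hf h.mem_polyhedron)
    have : 2 * σ₀ * (objective f x - objective f y) ≤ 0 :=
      mul_nonpos_of_nonpos_of_nonneg (by linarith) h4
    exact this.trans (sq_nonneg _)
  · have h4 : objective f x - objective f y ≤
        (R * Γ + B * deviation M s) * r - σ₀ / 2 * r ^ 2 := by linarith
    have h5 := mul_le_mul_of_nonneg_left h4 (by linarith : 0 ≤ 2 * σ₀)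
    -- Completing the square in r eliminates the unknown distance to the minimizer.
    nlinarith [sq_nonneg (R * Γ + B * deviation M s - σ₀ * r)]

theorem objective_sub_le_sampleObjective_sub {C : Fin m → Vec p} {d : Fin m → ℝ} {f : Fin n → Vec p → ℝ}
    {B : ℝ} (hB : ∀ x ∈ polyhedron C d, ∀ i, |f i x| ≤ B) (M : ℕ) (s : ℕ → Fin n) {x x' : Vec p}
    (hx : x ∈ polyhedron C d) (hx' : x' ∈ polyhedron C d) :
    objective f x' - objective f x ≤
      sampleObjective f M s x' - sampleObjective f M s x + 2 * B * deviation M s := by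
  have h1 := abs_le.1 (abs_sampleObjective_sub_le f M s x (hB x hx))
  have h2 := abs_le.1 (abs_sampleObjective_sub_le f M s x' (hB x' hx'))
  linarith [h1.1, h1.2, h2.1, h2.2]

/-- Along every sample path, the optimality gap decreases up to a multiple of the sampling error,
and it contracts over windows of `|V| + 1` iterations. -/
theorem exists_contraction (hn : 0 < n) {C : Fin m → Vec p} {d : Fin m → ℝ}
    (hcompact : IsCompact (polyhedron C d)) (hnontrivial : (polyhedron C d).Nontrivial)
    {f : Fin n → Vec p → ℝ} {σ : Fin n → ℝ} {L : Fin n → ℝ≥0} (hσpos : ∀ i, 0 < σ i)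
    (hσ : ∀ i, StrongConvexOn Set.univ (σ i) (f i)) (hf : ∀ i, Differentiable ℝ (f i))
    (hL : ∀ i, LipschitzWith (L i) (gradient (f i))) :
    ∃ ρ A : ℝ, 0 < ρ ∧ ρ < 1 ∧ 0 ≤ A ∧
      ∀ (carath : Bool) (M : ℕ → ℕ) (s : ℕ → ℕ → Fin n) (x : ℕ → Vec p) (w : ℕ → Vec p →₀ ℝ),
        (∀ k, 0 < M k) → IsRep C d (w 1) (x 1) →
        (∀ k, 1 ≤ k → IsStep C d f L carath (M k) (s k) (x k) (w k) (x (k + 1)) (w (k + 1))) →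
        (∀ k, 1 ≤ k → x k ∈ polyhedron C d) ∧
        ∀ k, 1 ≤ k → objective f (x (k + ((vertices C d).ncard + 1))) - optValue C d f ≤
            ρ * (objective f (x k) - optValue C d f) +
            A * ∑ j ∈ Finset.range ((vertices C d).ncard + 1), deviation (M (k + j)) (s (k + j)) := by
  have hV := nontrivial_vertices hcompact hnontrivial
  have : Nontrivial (Vec p) := by
    obtain ⟨x, -, y, -, hne⟩ := hnontrivial
    exact ⟨x, y, hne⟩
  have : Nonempty (Fin n) := ⟨⟨0, hn⟩⟩
  have hLpos : ∀ i, 0 < L i := fun i =>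
    lipschitz_pos_of_strongConvexOn (hf i) (hσpos i) (hσ i) (hL i)
  obtain ⟨i₀, hσ₀⟩ := Finite.exists_min σ
  obtain ⟨i₁, hK⟩ := Finite.exists_max fun i => (L i : ℝ)
  have hσ₀pos := hσpos i₀
  have hKpos : (0 : ℝ) < L i₁ := NNReal.coe_pos.2 (hLpos i₁)
  set σ₀ := σ i₀
  set K : ℝ := (L i₁).toReal
  obtain ⟨B, hBpos, hB⟩ := exists_uniform_bound (C := C) (d := d) hcompact hf hL
  set D := Metric.diam (polyhedron C d)
  have hDpos : 0 < D := diam_pos hcompact hnontrivial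
  have hD : ∀ x ∈ polyhedron C d, ∀ y ∈ polyhedron C d, ‖x - y‖ ≤ D := by
    intro x hx y hy
    rw [← dist_eq_norm]
    exact Metric.dist_le_diam_of_mem hcompact.isBounded hx hy
  set R : ℝ := (vertices C d).ncard / geomConst C d with hR
  have hRpos : 0 < R := by
    refine div_pos ?_ (geomConst_pos hV)
    exact_mod_cast (Set.ncard_pos (finite_vertices C d)).2 hV.nonempty
  set T := (vertices C d).ncard + 1 with hT
  have hTpos : (0 : ℝ) < T := by positivity
  set r := √σ₀ with hr
  have hrpos : 0 < r := Real.sqrt_pos.2 hσ₀pos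
  have hr2 : r ^ 2 = σ₀ := Real.sq_sqrt hσ₀pos.le
  -- With t = √h at the start of the window, half of the lower bound r t absorbs the noise; the
  -- other half makes every pairwise gap at least a t.
  set a := r / (2 * R) with ha
  have hapos : 0 < a := by positivity
  have haR : R * a = r / 2 := by rw [ha]; field_simp
  -- Noise threshold relative to t: the first bound preserves the pairwise gap, the second limits
  -- the noise in a gradient comparison to a quarter of a t.
  set η := min (r / (2 * B)) (a / (8 * B * D)) with hη
  have hηpos : 0 < η := by positivity
  have hη1 : B * η ≤ r / 2 := by
    have : η ≤ r / (2 * B) := min_le_left _ _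
    calc B * η ≤ B * (r / (2 * B)) := by gcongr
      _ = r / 2 := by field_simp
  have hη2 : 2 * B * η * D ≤ a / 4 := by
    have : η ≤ a / (8 * B * D) := min_le_right _ _
    calc 2 * B * η * D ≤ 2 * B * (a / (8 * B * D)) * D := by gcongr
      _ = a / 4 := by field_simp; norm_num
  -- The trial step is ε t. A full window of steps this short shifts the gradient pairing by at most
  -- a t / 2, and a step that is not short and maximal gains c t².
  set ε := a / (2 * K * T * D ^ 2) with hε
  have hεpos : 0 < ε := by positivity
  have hε1 : K * D ^ 2 * ε * T = a / 2 := by rw [hε]; field_simp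
  set c := ε * a / 2 with hc
  have hcpos : 0 < c := by positivity
  set ρ := max (1 / 2) (1 - c) with hρ
  have hρ1 : ρ < 1 := max_lt (by norm_num) (by linarith)
  refine ⟨ρ, 2 * B + n / η ^ 2, lt_of_lt_of_le (by norm_num) (le_max_left _ _), hρ1,
    by positivity, ?_⟩
  intro carath M s x w hM hrep1 hstep
  have hrep : ∀ k, 1 ≤ k → IsRep C d (w k) (x k) := by
    intro k hk
    induction k, hk using Nat.le_induction with
    | base => exact hrep1
    | succ k hk ih => exact ((hstep k hk).dichotomy hf hL hLpos hK hD (hM k) ih).1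
  have hP : ∀ k, 1 ≤ k → x k ∈ polyhedron C d := fun k hk => (hrep k hk).mem_polyhedron
  refine ⟨hP, fun k hk => ?_⟩
  have hdich := fun j => (hstep (k + j) (by omega)).dichotomy hf hL hLpos hK hD (hM (k + j))
    (hrep (k + j) (by omega))
  set dev : ℕ → ℝ := fun j => deviation (M (k + j)) (s (k + j)) with hdev
  have hdev0 : ∀ j, 0 ≤ dev j := fun j => deviation_nonneg _ _
  have hP' : ∀ j, x (k + j) ∈ polyhedron C d := fun j => hP _ (by omega)
  have hnoise : ∀ j, objective f (x (k + j + 1)) - objective f (x (k + j)) ≤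
      sampleObjective f (M (k + j)) (s (k + j)) (x (k + j + 1)) -
        sampleObjective f (M (k + j)) (s (k + j)) (x (k + j)) + 2 * B * dev j := fun j =>
    objective_sub_le_sampleObjective_sub (fun x hx i => (hB x hx i).1) _ _ (hP' j) (hP' (j + 1))
  choose hr' hdec q hqV u hu hq hmax hsupp hτ using hdich
  set h : ℕ → ℝ := fun j => objective f (x (k + j)) - optValue C d f with hh
  have hh0 : ∀ j, 0 ≤ h j := fun j => sub_nonneg.2 (optValue_le hcompact hf (hP' j))
  -- The gap with the accumulated noise removed is antitone, so a sufficient drop at any one time in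
  -- the window survives to its end.
  set ψ : ℕ → ℝ := fun j => h j - 2 * B * ∑ l ∈ Finset.range j, dev l with hψ
  have hψsucc : ∀ j, ψ (j + 1) = ψ j + (objective f (x (k + j + 1)) - objective f (x (k + j)) -
      2 * B * dev j) := by
    intro j
    simp only [hψ, hh, Finset.sum_range_succ, ← add_assoc]
    ring
  have hψanti : Antitone ψ := by
    refine antitone_nat_of_succ_le fun j => ?_
    rw [hψsucc]
    linarith [hnoise j, hdec j]
  have hψh : ∀ j, ψ j ≤ h j := fun j => by
    have : 0 ≤ ∑ l ∈ Finset.range j, dev l := Finset.sum_nonneg fun l _ => hdev0 l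
    simp only [hψ]
    linarith [mul_nonneg hBpos.le this]
  have hψ0 : ψ 0 = h 0 := by simp [hψ]
  have hS0 : 0 ≤ ∑ l ∈ Finset.range T, dev l := Finset.sum_nonneg fun l _ => hdev0 l
  have hgoal : ψ T ≤ ρ * h 0 + n / η ^ 2 * ∑ l ∈ Finset.range T, dev l → h T ≤ ρ * h 0 +
      (2 * B + n / η ^ 2) * ∑ l ∈ Finset.range T, dev l := by
    intro h1
    simp only [hψ] at h1
    linarith
  refine hgoal ?_
  have hS1 : 0 ≤ n / η ^ 2 * ∑ l ∈ Finset.range T, dev l := by positivity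
  have hρh : 1 / 2 * h 0 ≤ ρ * h 0 := mul_le_mul_of_nonneg_right (le_max_left _ _) (hh0 0)
  have hρc : (1 - c) * h 0 ≤ ρ * h 0 := mul_le_mul_of_nonneg_right (le_max_right _ _) (hh0 0)
  set t := √(h 0) with ht
  have ht2 : t ^ 2 = h 0 := Real.sq_sqrt (hh0 0)
  have ht0 : 0 ≤ t := Real.sqrt_nonneg _
  by_contra! hcon
  have htpos : 0 < t := by
    refine ht0.lt_of_ne fun h1 => ?_
    rw [← h1] at ht2
    have h2 := hψanti (Nat.zero_le T)
    rw [hψ0] at h2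
    have h3 : ρ * h 0 = 0 := by rw [← ht2]; ring
    linarith [hh0 0]
  -- A larger deviation would alone pay for `h 0`: as `dev j ≤ n`, its square is at most `n * dev
  -- j`, which turns the bound on t² into one linear in the deviation.
  have hsmall : ∀ j < T, dev j ≤ η * t := by
    intro j hj
    by_contra! h1
    have h2 : dev j ≤ n := deviation_le hn _ _
    have h3 : dev j ≤ ∑ l ∈ Finset.range T, dev l :=
      Finset.single_le_sum (fun l _ => hdev0 l) (Finset.mem_range.2 hj)
    have h4 : (η * t) ^ 2 ≤ n * dev j := by
      calc (η * t) ^ 2 ≤ dev j ^ 2 := by gcongr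
        _ ≤ n * dev j := by rw [sq]; exact mul_le_mul_of_nonneg_right h2 (hdev0 j)
    have h5 : h 0 ≤ n / η ^ 2 * dev j := by
      rw [div_mul_eq_mul_div, le_div_iff₀ (by positivity), ← ht2]
      linarith
    have h6 : n / η ^ 2 * dev j ≤ n / η ^ 2 * ∑ l ∈ Finset.range T, dev l := by gcongr
    have h7 := hψanti (Nat.zero_le T)
    rw [hψ0] at h7
    have h8 := mul_nonneg (lt_of_lt_of_le (by norm_num : (0 : ℝ) < 1 / 2) (le_max_left _ _)).le
      (hh0 0) (a := ρ)
    linarith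
  have hhalf : ∀ j < T, h 0 / 2 < h j := by
    intro j hj
    by_contra! h1
    have := hψanti hj.le
    linarith [hψh j]
  have hΓ : ∀ j < T, a * t ≤ inner ℝ (sampleGradient f (M (k + j)) (s (k + j)) (x (k + j)))
      (u j - q j) := by
    intro j hj
    have h1 := (hrep (k + j) (by omega)).optimality_gap_le hn hcompact hV hf hσ hσ₀
      (fun i => (hB _ (hP' j) i).2) (M (k + j)) (s (k + j)) (hq j) (hmax j)
    set Γ : ℝ := inner ℝ (sampleGradient f (M (k + j)) (s (k + j)) (x (k + j))) (u j - q j) with hΓ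
    have hΓ0 : 0 ≤ Γ := by
      rw [hΓ, inner_sub_right]
      have := hq j (u j) (mem_polyhedron_of_mem_vertices
        ((hrep (k + j) (by omega)).support_subset _ (hu j)))
      linarith
    have h2 : (r * t) ^ 2 ≤ (R * Γ + B * dev j) ^ 2 := by
      refine le_trans ?_ h1
      have := mul_le_mul_of_nonneg_left (hhalf j hj).le (by positivity : 0 ≤ 2 * σ₀)
      rw [mul_pow, hr2, ht2]
      linarith
    have h3 : r * t ≤ R * Γ + B * dev j :=
      (abs_le_of_sq_le_sq' h2 (by have := hdev0 j; positivity)).2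
    have h4 : B * dev j ≤ r / 2 * t := by
      calc B * dev j ≤ B * (η * t) := by gcongr; exact hsmall j hj
        _ = B * η * t := by ring
        _ ≤ r / 2 * t := by gcongr
    have h5 : R * (a * t) ≤ R * Γ := by
      rw [← mul_assoc, haR]
      linarith
    exact le_of_mul_le_mul_left h5 hRpos
  have hT1 : (1 : ℝ) ≤ T := by rw [hT]; push_cast; linarith [Nat.cast_nonneg (α := ℝ) (vertices C d).ncard]
  -- A single step of the other kind would lower ψ by c `h 0`, already enough for the contraction.
  have hshort : ∀ j < T, ‖x (k + j + 1) - x (k + j)‖ ≤ ε * t * D ∧ u j ∉ (w (k + j + 1)).support := by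
    intro j hj
    have h1 := hΓ j hj
    have h2 : K * D ^ 2 * (ε * t) < a * t := by
      have h3 : K * D ^ 2 * ε ≤ K * D ^ 2 * ε * T := le_mul_of_one_le_right (by positivity) hT1
      have h4 : K * D ^ 2 * ε < a := by linarith
      have := mul_lt_mul_of_pos_right h4 htpos
      linarith
    refine (hτ j (ε * t) (by positivity) (h2.trans_le h1)).resolve_left fun h3 => ?_
    have h4 : c * h 0 ≤ ε * t / 2 * inner ℝ (sampleGradient f (M (k + j)) (s (k + j)) (x (k + j)))
        (u j - q j) := by
      calc c * h 0 = ε * t / 2 * (a * t) := by rw [hc, ← ht2]; ring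
        _ ≤ _ := by gcongr
    have h5 := hψsucc j
    have h6 := hnoise j
    have h7 := hψanti (Nat.zero_le j)
    have h8 := hψanti (Nat.succ_le_of_lt hj)
    rw [Nat.succ_eq_add_one] at h8
    linarith
  obtain ⟨i, hi, j, hj, hij⟩ := exists_vertex_repeat (V := (finite_vertices C d).toFinset) (T := T)
    (by rw [← Set.ncard_eq_toFinset_card _ (finite_vertices C d)]; omega)
    (S := fun j => (w (k + j)).support) (u := u) (q := q)
    (g := fun j => sampleGradient f (M (k + j)) (s (k + j)) (x (k + j))) (a := a * t)
    (fun j _ => by simpa using (hrep (k + j) (by omega)).support_subset _ (hu j))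
    (fun j _ => hu j) (fun j hj => (hshort j hj).2) (fun j _ => hsupp j)
    (fun i _ j _ => hq i _ (mem_polyhedron_of_mem_vertices (hqV j))) hΓ
  have hmove : ∀ i ≤ T, ∀ j ≤ T, i ≤ j → ‖x (k + j) - x (k + i)‖ ≤ T * (ε * t * D) := by
    intro i _ j hj hij
    rw [← dist_eq_norm, dist_comm]
    have h1 := dist_le_Ico_sum_of_dist_le (f := fun j => x (k + j)) hij
      (d := fun _ => ε * t * D) (fun {l} _ hl => by
        rw [dist_comm, dist_eq_norm]
        exact (hshort l (hl.trans_le hj)).1)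
    refine h1.trans ?_
    rw [Finset.sum_const, Nat.card_Ico, nsmul_eq_mul]
    have : ((j - i : ℕ) : ℝ) ≤ T := by exact_mod_cast (Nat.sub_le j i).trans hj
    gcongr
  have hmove' : ‖x (k + j) - x (k + i)‖ ≤ T * (ε * t * D) := by
    rcases le_total i j with hle | hle
    · exact hmove i hi.le j hj.le hle
    · rw [norm_sub_rev]
      exact hmove j hj.le i hi.le hle
  have hgrad : ‖sampleGradient f (M (k + j)) (s (k + j)) (x (k + j)) -
      sampleGradient f (M (k + i)) (s (k + i)) (x (k + i))‖ ≤
      B * (η * t) + K * (T * (ε * t * D)) + B * (η * t) := by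
    have h1 := norm_sampleGradient_sub_le f (M (k + j)) (s (k + j)) (x (k + j))
      fun i => (hB _ (hP' j) i).2
    have h2 := norm_sampleGradient_sub_le f (M (k + i)) (s (k + i)) (x (k + i))
      fun i' => (hB _ (hP' i) i').2
    have h3 := norm_meanGradient_sub_le hL hn hK (x (k + j)) (x (k + i))
    have h4 := mul_le_mul_of_nonneg_left (hsmall j hj) hBpos.le
    have h5 := mul_le_mul_of_nonneg_left (hsmall i hi) hBpos.le
    have h6 := mul_le_mul_of_nonneg_left hmove' hKpos.le
    rw [norm_sub_rev] at h2
    refine le_trans ?_ (add_le_add (add_le_add (h1.trans h4) (h3.trans h6)) (h2.trans h5))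
    refine le_trans (le_of_eq ?_) (norm_add₃_le)
    congr 1
    abel
  have huq : ‖u j - q j‖ ≤ D := hD _ (mem_polyhedron_of_mem_vertices
    ((hrep (k + j) (by omega)).support_subset _ (hu j))) _
    (mem_polyhedron_of_mem_vertices (hqV j))
  have hfinal : a * t ≤ (B * (η * t) + K * (T * (ε * t * D)) + B * (η * t)) * D := by
    refine hij.trans ((real_inner_le_norm _ _).trans ?_)
    gcongr
  have heq : (B * (η * t) + K * (T * (ε * t * D)) + B * (η * t)) * D =
      (2 * B * η * D + K * D ^ 2 * ε * T) * t := by ring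
  -- Noise contributes at most a/4 and drift a/2, together less than a: a contradiction.
  rw [heq, hε1] at hfinal
  have := le_of_mul_le_mul_right hfinal htpos
  linarith

end Contraction

/-! ### Linear rates from delayed recursions. -/

section Sequences

theorem exists_linear_rate (T : ℕ) {ρ A β H : ℝ} (hρ : ρ < 1) (hρ0 : 0 ≤ ρ) (hA : 0 ≤ A)
    (hβ0 : 0 ≤ β) (hβ : β < 1) :
    ∃ r c : ℝ, 0 < r ∧ r < 1 ∧ 0 ≤ c ∧ ∀ a : ℕ → ℝ, (∀ k, 1 ≤ k → a k ≤ H) →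
      (∀ k, 1 ≤ k → a (k + T) ≤ ρ * a k + A * β ^ k) → ∀ k, 1 ≤ k → a k ≤ c * r ^ k := by
  -- Close to 1, r beats both the window contraction and the noise rate β. In c, the first term
  -- covers the first T indices and the second absorbs the noise in the induction.
  have h1 : ∀ᶠ r in 𝓝[<] (1 : ℝ), ρ < r ^ T := by
    have hc : Continuous fun r : ℝ => r ^ T := by fun_prop
    have : ρ < (1 : ℝ) ^ T := by simpa using hρ
    exact ((hc.tendsto 1).eventually_const_lt this).filter_mono nhdsWithin_le_nhds
  have h2 : ∀ᶠ r in 𝓝[<] (1 : ℝ), r ∈ Ioo (max β 0) 1 :=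
    Ioo_mem_nhdsLT (max_lt hβ zero_lt_one)
  obtain ⟨r, hr, hrβ, hr1⟩ := (h1.and h2).exists
  have hr0 : 0 < r := (le_max_right _ _).trans_lt hrβ
  have hβr : β < r := (le_max_left _ _).trans_lt hrβ
  have hd : 0 < r ^ T - ρ := sub_pos.2 hr
  have hrT : 0 < r ^ T := pow_pos hr0 T
  refine ⟨r, |H| / r ^ T + A / (r ^ T - ρ), hr0, hr1, by positivity, ?_⟩
  intro a haH hrec k
  set c := |H| / r ^ T + A / (r ^ T - ρ) with hc
  have hc0 : 0 ≤ c := by positivity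
  induction k using Nat.strong_induction_on with
  | _ k ih =>
    intro hk
    rcases le_or_gt k T with hkT | hkT
    · calc a k ≤ |H| := (haH k hk).trans (le_abs_self _)
        _ = |H| / r ^ T * r ^ T := by field_simp
        _ ≤ c * r ^ k := by
          have h3 : |H| / r ^ T ≤ c := le_add_of_nonneg_right (by positivity)
          have h4 : r ^ T ≤ r ^ k := pow_le_pow_of_le_one hr0.le hr1.le hkT
          gcongr
    · obtain ⟨l, rfl⟩ := Nat.exists_eq_add_of_le' hkT.le
      -- For T = 0 the recursion does not reach an earlier index and is solved directly for `a l`.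
      rcases Nat.eq_zero_or_pos T with rfl | hT
      · have h3 := hrec l hk
        have h4 : A * β ^ l ≤ A * r ^ l := by gcongr
        have h5 : A / (1 - ρ) ≤ c := by
          rw [hc]; simp only [pow_zero]; exact le_add_of_nonneg_left (by positivity)
        simp only [pow_zero] at hd
        rw [div_le_iff₀ hd] at h5
        have h6 := mul_le_mul_of_nonneg_right h5 (pow_nonneg hr0.le l)
        simp only [add_zero] at h3 ⊢
        have h7 : (1 - ρ) * a l ≤ (1 - ρ) * (c * r ^ l) := by linarith
        exact le_of_mul_le_mul_left h7 hd
      · have hl : 1 ≤ l := by omega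
        have h3 := ih l (by omega) hl
        have h4 : A ≤ c * (r ^ T - ρ) := by
          rw [← div_le_iff₀ hd, hc]
          exact le_add_of_nonneg_left (by positivity)
        calc a (l + T) ≤ ρ * a l + A * β ^ l := hrec l hl
          _ ≤ ρ * (c * r ^ l) + c * (r ^ T - ρ) * r ^ l := by gcongr
          _ = c * r ^ (l + T) := by ring

theorem convergesLinearly_of_tendsto {a : ℕ → ℝ} {l b : ℝ} (hb0 : 0 < b) (hb1 : b < 1)
    (h : Tendsto (fun k => (a k - l) / b ^ k) atTop (𝓝 0)) : ConvergesLinearly a l := by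
  obtain ⟨c, hc⟩ := h.abs.bddAbove_range
  refine ⟨b, c, hb0, hb1, fun k _ => ?_⟩
  have h1 : |(a k - l) / b ^ k| ≤ c := hc ⟨k, rfl⟩
  rwa [abs_div, abs_of_pos (pow_pos hb0 k), div_le_iff₀ (pow_pos hb0 k)] at h1

end Sequences

/-! ### Expected sampling error and almost sure convergence. -/

section Probability

variable {Ω : Type*} [MeasurableSpace Ω] {P : Measure Ω}

/-- By Tonelli the sum of the f k has finite integral, so it is finite almost everywhere and its
terms tend to zero. -/
theorem ae_tendsto_zero_of_integral_le_geometric {f : ℕ → Ω → ℝ} (hf : ∀ k, Integrable (f k) P)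
    (hf0 : ∀ k ω, 0 ≤ f k ω) {c θ : ℝ} (hθ0 : 0 ≤ θ) (hθ : θ < 1)
    (h : ∀ k, ∫ ω, f k ω ∂P ≤ c * θ ^ k) :
    ∀ᵐ ω ∂P, Tendsto (fun k => f k ω) atTop (𝓝 0) := by
  have hsum : Summable fun k => ∫ ω, f k ω ∂P :=
    Summable.of_nonneg_of_le (fun k => integral_nonneg (hf0 k)) h
      ((summable_geometric_of_lt_one hθ0 hθ).mul_left c)
  have h1 : ∫⁻ ω, ∑' k, ENNReal.ofReal (f k ω) ∂P ≠ ∞ := by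
    rw [lintegral_tsum fun k => (hf k).aemeasurable.ennreal_ofReal]
    simp only [← ofReal_integral_eq_lintegral_ofReal (hf _) (Eventually.of_forall (hf0 _))]
    exact hsum.tsum_ofReal_ne_top
  have h2 := ae_lt_top' (AEMeasurable.tsum fun k => (hf k).aemeasurable.ennreal_ofReal) h1
  filter_upwards [h2] with ω hω
  have h3 := (ENNReal.summable_toReal hω.ne).tendsto_atTop_zero
  simpa only [ENNReal.toReal_ofReal (hf0 _ ω)] using h3

variable [IsProbabilityMeasure P] {n : ℕ}

theorem measurable_freq {ξ : ℕ → Ω → Fin n} (hmeas : ∀ j, Measurable (ξ j)) (M : ℕ) (i : Fin n) :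
    Measurable fun ω => freq M (fun j => ξ j ω) i := by
  unfold freq
  refine Measurable.div_const (Finset.measurable_sum _ fun j _ => ?_) _
  exact (measurable_of_finite fun a : Fin n => if a = i then (1 : ℝ) else 0).comp (hmeas j)

theorem integrable_deviation (hn : 0 < n) {ξ : ℕ → Ω → Fin n} (hmeas : ∀ j, Measurable (ξ j))
    (M : ℕ) : Integrable (fun ω => deviation M (fun j => ξ j ω)) P := by
  refine Integrable.of_bound (C := n) ?_ (Eventually.of_forall fun ω => ?_)
  · refine (Finset.measurable_sum _ fun i _ => ?_).aestronglyMeasurable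
    exact ((measurable_freq hmeas M i).sub_const _).abs
  · rw [Real.norm_of_nonneg (deviation_nonneg _ _)]
    exact deviation_le hn _ _

/-- The mean square error of the sampled frequencies. -/
theorem integral_sq_freq_sub_le {ξ : ℕ → Ω → Fin n} (hmeas : ∀ j, Measurable (ξ j))
    (hunif : ∀ j i, P {ω | ξ j ω = i} = (n : ℝ≥0∞)⁻¹) (hindep : iIndepFun ξ P) {M : ℕ}
    (hM : 0 < M) (i : Fin n) :
    ∫ ω, (freq M (fun j => ξ j ω) i - (n : ℝ)⁻¹) ^ 2 ∂P ≤ 1 / M := by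
  have hM' : (0 : ℝ) < M := by exact_mod_cast hM
  set e : Fin n → ℝ := fun a => if a = i then 1 else 0 with he
  have he01 : ∀ a, e a ∈ Icc (0 : ℝ) 1 := fun a => by
    simp only [he]; split_ifs <;> simp
  have hX : ∀ j, Measurable (e ∘ ξ j) := fun j => (measurable_of_finite e).comp (hmeas j)
  have hL2 : ∀ j, MemLp (e ∘ ξ j) 2 P := fun j =>
    MemLp.of_bound (hX j).aestronglyMeasurable 1 (Eventually.of_forall fun ω => by
      rw [Function.comp_apply, Real.norm_of_nonneg (he01 _).1]; exact (he01 _).2)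
  have hint : ∀ j, ∫ ω, (e ∘ ξ j) ω ∂P = (n : ℝ)⁻¹ := by
    intro j
    have h1 : (e ∘ ξ j) = {ω | ξ j ω = i}.indicator 1 := by
      ext ω
      simp [he, Set.indicator_apply]
    rw [h1, integral_indicator_one (s := {ω | ξ j ω = i}) (hmeas j (measurableSet_singleton i)),
      Measure.real, hunif]
    simp
  have hvar : ∀ j, Var[e ∘ ξ j; P] ≤ 1 := by
    intro j
    refine (variance_le_expectation_sq (hX j).aestronglyMeasurable).trans ?_
    have h2 : ∫ ω, ((e ∘ ξ j) ^ 2) ω ∂P ≤ ∫ _, (1 : ℝ) ∂P := by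
      refine integral_mono_of_nonneg (Eventually.of_forall fun ω => ?_) (integrable_const _)
        (Eventually.of_forall fun ω => ?_)
      · exact sq_nonneg _
      · exact pow_le_one₀ (he01 _).1 (he01 _).2
    simpa using h2
  have hfreq : (fun ω => freq M (fun j => ξ j ω) i) =
      fun ω => (M : ℝ)⁻¹ * (∑ j ∈ Finset.range M, e ∘ ξ j) ω := by
    ext ω
    rw [freq, Finset.sum_apply, div_eq_inv_mul]
    rfl
  have hmean : ∫ ω, freq M (fun j => ξ j ω) i ∂P = (n : ℝ)⁻¹ := by
    rw [hfreq, integral_const_mul]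
    simp only [Finset.sum_apply]
    rw [integral_finsetSum _ fun j _ => (hL2 j).integrable one_le_two]
    simp only [hint]
    rw [Finset.sum_const, Finset.card_range, nsmul_eq_mul]
    field_simp
  have h3 := variance_eq_integral (measurable_freq hmeas M i).aemeasurable (μ := P)
  rw [hmean] at h3
  rw [← h3, hfreq, variance_const_mul, IndepFun.variance_sum (fun j _ => hL2 j)
    (fun a _ b _ hab => (hindep.indepFun hab).comp (measurable_of_finite e)
      (measurable_of_finite e))]
  calc (M : ℝ)⁻¹ ^ 2 * ∑ j ∈ Finset.range M, Var[e ∘ ξ j; P] ≤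
      (M : ℝ)⁻¹ ^ 2 * ∑ j ∈ Finset.range M, (1 : ℝ) := by
        gcongr with j _
        exact hvar j
    _ = 1 / (M : ℝ) := by
        rw [Finset.sum_const, Finset.card_range, nsmul_eq_mul]
        field_simp

theorem integral_deviation_le {ξ : ℕ → Ω → Fin n} (hmeas : ∀ j, Measurable (ξ j))
    (hunif : ∀ j i, P {ω | ξ j ω = i} = (n : ℝ≥0∞)⁻¹) (hindep : iIndepFun ξ P) {M : ℕ}
    (hM : 0 < M) :
    ∫ ω, deviation M (fun j => ξ j ω) ∂P ≤ n * (1 / √M) := by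
  have hM' : (0 : ℝ) < M := by exact_mod_cast hM
  set S := √(M : ℝ) with hS
  have hSpos : 0 < S := Real.sqrt_pos.2 hM'
  have hS2 : S ^ 2 = M := Real.sq_sqrt hM'.le
  have hbdd : ∀ i ω, |freq M (fun j => ξ j ω) i - (n : ℝ)⁻¹| ≤ 1 + |(n : ℝ)⁻¹| := fun i ω => by
    have h := freq_mem_Icc M (fun j => ξ j ω) i
    refine (abs_sub _ _).trans ?_
    rw [abs_of_nonneg h.1]
    linarith [h.2]
  have hm : ∀ i, Measurable fun ω => freq M (fun j => ξ j ω) i - (n : ℝ)⁻¹ := fun i =>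
    (measurable_freq hmeas M i).sub_const _
  have hi1 : ∀ i, Integrable (fun ω => |freq M (fun j => ξ j ω) i - (n : ℝ)⁻¹|) P := fun i =>
    Integrable.of_bound (hm i).abs.aestronglyMeasurable _ (Eventually.of_forall fun ω => by
      rw [Real.norm_eq_abs, abs_abs]; exact hbdd i ω)
  have hi2 : ∀ i, Integrable (fun ω => (freq M (fun j => ξ j ω) i - (n : ℝ)⁻¹) ^ 2) P := fun i =>
    Integrable.of_bound ((hm i).pow_const 2).aestronglyMeasurable ((1 + |(n : ℝ)⁻¹|) ^ 2)
      (Eventually.of_forall fun ω => by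
        rw [Real.norm_eq_abs, abs_pow]
        exact pow_le_pow_left₀ (abs_nonneg _) (hbdd i ω) 2)
  unfold deviation
  rw [integral_finsetSum _ fun i _ => hi1 i]
  calc _ ≤ ∑ i : Fin n, 1 / S := ?_
    _ = n * (1 / S) := by simp
  refine Finset.sum_le_sum fun i _ => ?_
  calc ∫ ω, |freq M (fun j => ξ j ω) i - (n : ℝ)⁻¹| ∂P
      -- Young's inequality in place of Cauchy–Schwarz; the weight S = √M balances the variance
      -- bound 1/M.
      ≤ ∫ ω, (S / 2 * (freq M (fun j => ξ j ω) i - (n : ℝ)⁻¹) ^ 2 + 1 / (2 * S)) ∂P := by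
        refine integral_mono (hi1 i) (((hi2 i).const_mul _).add (integrable_const _)) fun ω => ?_
        simp only
        set y := freq M (fun j => ξ j ω) i - (n : ℝ)⁻¹
        have h1 : 0 ≤ (S * |y| - 1) ^ 2 / (2 * S) := by positivity
        have h2 : (S * |y| - 1) ^ 2 / (2 * S) = S / 2 * y ^ 2 + 1 / (2 * S) - |y| := by
          rw [← sq_abs y]
          field_simp
          ring
        linarith
    _ = S / 2 * ∫ ω, (freq M (fun j => ξ j ω) i - (n : ℝ)⁻¹) ^ 2 ∂P + 1 / (2 * S) := by
        rw [integral_add ((hi2 i).const_mul _) (integrable_const _), integral_const_mul]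
        simp
    _ ≤ S / 2 * (1 / M) + 1 / (2 * S) := by
        gcongr
        exact integral_sq_freq_sub_le hmeas hunif hindep hM i
    _ = 1 / S := by
        rw [← hS2]
        field_simp
        norm_num

end Probability

/-! ### Expected linear rate of a run. -/

section Run

variable {p m n : ℕ}

theorem kappa_pos (hn : 0 < n) {C : Fin m → Vec p} {d : Fin m → ℝ}
    (hcompact : IsCompact (polyhedron C d)) (hnontrivial : (polyhedron C d).Nontrivial)
    {σ : Fin n → ℝ} {L : Fin n → ℝ≥0} (hσ : ∀ i, 0 < σ i) (hL : ∀ i, 0 < L i) (carath : Bool) :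
    0 < kappa C d σ L carath := by
  have : Nonempty (Fin n) := ⟨⟨0, hn⟩⟩
  have hV := nontrivial_vertices hcompact hnontrivial
  have h1 := geomConst_pos hV
  have h2 : 0 < ⨅ i, σ i := by
    obtain ⟨i, hi⟩ := exists_eq_ciInf_of_finite (f := σ)
    rw [← hi]
    exact hσ i
  have h3 : 0 < ⨆ i, (L i : ℝ) := by
    obtain ⟨i, hi⟩ := exists_eq_ciSup_of_finite (f := fun i => (L i : ℝ))
    rw [← hi]
    exact NNReal.coe_pos.2 (hL i)
  have h4 : (0 : ℝ) < repSize C d carath := by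
    have : 0 < repSize C d carath := by
      unfold repSize
      split_ifs
      · omega
      · exact (Set.ncard_pos (finite_vertices C d)).2 hV.nonempty
    exact_mod_cast this
  have h5 := diam_pos hcompact hnontrivial
  exact lt_min (by norm_num) (div_pos (mul_pos (pow_pos h1 2) h2)
    (mul_pos (mul_pos (mul_pos (by norm_num) (pow_pos h4 2)) h3) (pow_pos h5 2)))

theorem sampleSize_pos {κ : ℝ} (hκ : κ < 1) (k : ℕ) : 0 < sampleSize κ k := by
  have : 0 < 1 - κ := by linarith
  exact Nat.ceil_pos.2 (div_pos one_pos (pow_pos this _))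

theorem one_div_sqrt_sampleSize_le {κ : ℝ} (hκ : κ < 1) (k : ℕ) :
    1 / √(sampleSize κ k : ℝ) ≤ (1 - κ) ^ (k + 1) := by
  have h0 : 0 < 1 - κ := by linarith
  have h1 : 1 / (1 - κ) ^ (2 * k + 2) ≤ (sampleSize κ k : ℝ) := Nat.le_ceil _
  have h2 : 1 / (1 - κ) ^ (k + 1) ≤ √(sampleSize κ k : ℝ) := by
    refine Real.le_sqrt_of_sq_le (le_trans (le_of_eq ?_) h1)
    rw [div_pow, one_pow, ← pow_mul]
    congr 2
    ring
  exact (div_le_comm₀ (pow_pos h0 _)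
    (Real.sqrt_pos.2 (Nat.cast_pos.2 (sampleSize_pos hκ k)))).1 h2

/-- The expected optimality gap decreases at a linear rate that depends on the problem data only. -/
theorem exists_expected_rate (hn : 0 < n) {C : Fin m → Vec p} {d : Fin m → ℝ}
    (hcompact : IsCompact (polyhedron C d)) (hnontrivial : (polyhedron C d).Nontrivial)
    {f : Fin n → Vec p → ℝ} {σ : Fin n → ℝ} {L : Fin n → ℝ≥0} (hσpos : ∀ i, 0 < σ i)
    (hσ : ∀ i, StrongConvexOn Set.univ (σ i) (f i)) (hf : ∀ i, Differentiable ℝ (f i))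
    (hL : ∀ i, LipschitzWith (L i) (gradient (f i))) {κ : ℝ} (hκ0 : 0 < κ) (hκ : κ < 1) :
    ∃ r c : ℝ, 0 < r ∧ r < 1 ∧ 0 ≤ c ∧
      ∀ (carath : Bool) (Ω : Type*) [MeasurableSpace Ω] (P : Measure Ω) [IsProbabilityMeasure P]
        (ξ : ℕ → ℕ → Ω → Fin n) (x₁ : Vec p) (x : ℕ → Ω → Vec p),
        IsRun C d f L carath (sampleSize κ) P ξ x₁ x → ∀ k, 1 ≤ k →
          (∀ ω, 0 ≤ objective f (x k ω) - optValue C d f) ∧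
          Integrable (fun ω => objective f (x k ω) - optValue C d f) P ∧
          ∫ ω, (objective f (x k ω) - optValue C d f) ∂P ≤ c * r ^ k := by
  obtain ⟨ρ, A, hρ0, hρ1, hA, hcontr⟩ :=
    exists_contraction hn hcompact hnontrivial hσpos hσ hf hL
  set T := (vertices C d).ncard + 1 with hT
  obtain ⟨H, hH⟩ := hcompact.exists_bound_of_continuousOn
    (f := fun x => objective f x - optValue C d f)
    ((continuous_objective hf).sub continuous_const).continuousOn
  obtain ⟨r, c, hr0, hr1, hc, hrate⟩ := exists_linear_rate T (A := A * (T * n)) (β := 1 - κ)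
    (H := H) hρ1 hρ0.le (by positivity) (by linarith) (by linarith)
  refine ⟨r, c, hr0, hr1, hc, ?_⟩
  intro carath Ω _ P _ ξ x₁ x hrun
  have hpath : ∀ ω, (∀ k, 1 ≤ k → x k ω ∈ polyhedron C d) ∧
      ∀ k, 1 ≤ k → objective f (x (k + T) ω) - optValue C d f ≤
        ρ * (objective f (x k ω) - optValue C d f) + A * ∑ j ∈ Finset.range T,
          deviation (sampleSize κ (k + j)) (fun i => ξ (k + j) i ω) := by
    intro ω
    obtain ⟨w, hx1, hw1, hstep⟩ := hrun.path ω
    refine hcontr carath (sampleSize κ) (fun k j => ξ k j ω) (fun k => x k ω) w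
      (sampleSize_pos hκ) ?_ hstep
    simp only [hx1, hw1]
    exact IsRep.single hrun.start_mem
  have hint : ∀ k, 1 ≤ k → Integrable (fun ω => objective f (x k ω) - optValue C d f) P := by
    intro k hk
    refine Integrable.of_bound (C := H) ?_ (Eventually.of_forall fun ω => hH _ ((hpath ω).1 k hk))
    exact (((continuous_objective hf).measurable.comp
      (hrun.measurable_iterate k hk)).sub_const _).aestronglyMeasurable
  have hdevint : ∀ k, Integrable (fun ω => deviation (sampleSize κ k) (fun i => ξ k i ω)) P :=
    fun k => integrable_deviation hn (hrun.measurable_sample k) _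
  have hdev : ∀ k, ∫ ω, deviation (sampleSize κ k) (fun i => ξ k i ω) ∂P ≤
      n * (1 - κ) ^ (k + 1) := by
    intro k
    have hinj : Function.Injective fun j : ℕ => (k, j) := fun a b h => (Prod.mk.inj h).2
    refine (integral_deviation_le (hrun.measurable_sample k) (hrun.uniform_sample k)
      (iIndepFun.precomp (f := fun kj : ℕ × ℕ => ξ kj.1 kj.2) hinj hrun.indep_sample) (sampleSize_pos hκ k)).trans ?_
    gcongr
    exact one_div_sqrt_sampleSize_le hκ k
  intro k hk
  refine ⟨fun ω => sub_nonneg.2 (optValue_le hcompact hf ((hpath ω).1 k hk)), hint k hk, ?_⟩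
  refine hrate (fun k => ∫ ω, (objective f (x k ω) - optValue C d f) ∂P) ?_ ?_ k hk
  · intro k hk
    have h1 : ∫ ω, (objective f (x k ω) - optValue C d f) ∂P ≤ ∫ _, H ∂P :=
      integral_mono (hint k hk) (integrable_const _) fun ω =>
        (le_abs_self _).trans (hH _ ((hpath ω).1 k hk))
    simpa using h1
  · intro k hk
    have hsumint : Integrable (fun ω => ∑ j ∈ Finset.range T,
        deviation (sampleSize κ (k + j)) (fun i => ξ (k + j) i ω)) P :=
      integrable_finsetSum _ fun j _ => hdevint (k + j)
    calc ∫ ω, (objective f (x (k + T) ω) - optValue C d f) ∂P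
        ≤ ∫ ω, (ρ * (objective f (x k ω) - optValue C d f) + A * ∑ j ∈ Finset.range T,
          deviation (sampleSize κ (k + j)) (fun i => ξ (k + j) i ω)) ∂P :=
          integral_mono (hint _ (by omega)) (((hint k hk).const_mul _).add (hsumint.const_mul _))
            fun ω => (hpath ω).2 k hk
      _ = ρ * ∫ ω, (objective f (x k ω) - optValue C d f) ∂P + A * ∑ j ∈ Finset.range T,
          ∫ ω, deviation (sampleSize κ (k + j)) (fun i => ξ (k + j) i ω) ∂P := by
          rw [integral_add ((hint k hk).const_mul _) (hsumint.const_mul _), integral_const_mul,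
            integral_const_mul, integral_finsetSum _ fun j _ => hdevint (k + j)]
      _ ≤ ρ * ∫ ω, (objective f (x k ω) - optValue C d f) ∂P + A * ∑ j ∈ Finset.range T,
          n * (1 - κ) ^ k := by
          gcongr with j _
          refine (hdev (k + j)).trans ?_
          -- Every deviation in the window is charged at the rate of its first index, whence the
          -- factor T n in the noise constant.
          have : (1 - κ) ^ (k + j + 1) ≤ (1 - κ) ^ k :=
            pow_le_pow_of_le_one (by linarith) (by linarith) (by omega)
          gcongr
      _ = _ := by
          rw [Finset.sum_const, Finset.card_range, nsmul_eq_mul]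
          ring

end Run

end PSFW

end

/-! ### The main theorem. -/

theorem corollary4 {p m n : ℕ} (hn : 0 < n)
    (C : Fin m → PSFW.Vec p) (d : Fin m → ℝ)
    (hcompact : IsCompact (PSFW.polyhedron C d))
    (hnontrivial : (PSFW.polyhedron C d).Nontrivial)
    (f : Fin n → PSFW.Vec p → ℝ) (σ : Fin n → ℝ) (L : Fin n → ℝ≥0)
    (hσ : ∀ i, 0 < σ i)
    (hconvex : ∀ i, StrongConvexOn Set.univ (σ i) (f i))
    (hdiff : ∀ i, Differentiable ℝ (f i))
    (hlip : ∀ i, LipschitzWith (L i) (gradient (f i)))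
    (carath : Bool) :
    ∃ φ C₃ ψ : ℝ, 0 < φ ∧ φ < PSFW.kappa C d σ L carath ∧ 0 < ψ ∧ ψ < φ ∧
      ∀ (Ω : Type*) [MeasurableSpace Ω] (P : Measure Ω) [IsProbabilityMeasure P]
        (ξ : ℕ → ℕ → Ω → Fin n) (x₁ : PSFW.Vec p) (x : ℕ → Ω → PSFW.Vec p),
        PSFW.IsRun C d f L carath (PSFW.sampleSize (PSFW.kappa C d σ L carath)) P ξ x₁ x →
        (∀ k : ℕ, 1 ≤ k →
          Integrable (fun ω => PSFW.objective f (x (k + 1) ω) - PSFW.optValue C d f) P ∧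
          ∫ ω, (PSFW.objective f (x (k + 1) ω) - PSFW.optValue C d f) ∂P ≤
            C₃ * (1 - φ) ^ ((k : ℝ) / (3 * ((PSFW.vertices C d).ncard.factorial : ℝ) + 1))) ∧
        (∀ᵐ ω ∂P, Tendsto
          (fun k : ℕ => (PSFW.objective f (x k ω) - PSFW.optValue C d f) /
            (1 - ψ) ^ ((k : ℝ) / (3 * ((PSFW.vertices C d).ncard.factorial : ℝ) + 1)))
          atTop (𝓝 0)) ∧
        (∀ᵐ ω ∂P, PSFW.ConvergesLinearly
          (fun k => PSFW.objective f (x k ω)) (PSFW.optValue C d f)) := by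
  have : Nontrivial (PSFW.Vec p) := by
    obtain ⟨x, -, y, -, hne⟩ := hnontrivial
    exact ⟨x, y, hne⟩
  have hL : ∀ i, 0 < L i := fun i =>
    PSFW.lipschitz_pos_of_strongConvexOn (hdiff i) (hσ i) (hconvex i) (hlip i)
  set κ := PSFW.kappa C d σ L carath with hκdef
  have hκ0 : 0 < κ := PSFW.kappa_pos hn hcompact hnontrivial hσ hL carath
  have hκ1 : κ < 1 := (min_le_left _ _).trans_lt (by norm_num)
  obtain ⟨r, c, hr0, hr1, hc, hrate⟩ :=
    PSFW.exists_expected_rate hn hcompact hnontrivial hσ hconvex hdiff hlip hκ0 hκ1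
  set Q : ℝ := 3 * ((PSFW.vertices C d).ncard.factorial : ℝ) + 1 with hQ
  have hQpos : 0 < Q := by positivity
  -- As φ tends to 0 the right side tends to 1, so the prescribed exponent accommodates any rate r <
  -- 1.
  have hev : ∀ᶠ φ in 𝓝[>] (0 : ℝ), r < (1 - φ) ^ (1 / Q) := by
    have hcont : ContinuousAt (fun φ : ℝ => (1 - φ) ^ (1 / Q)) 0 :=
      ContinuousAt.rpow_const (by fun_prop) (Or.inl (by norm_num))
    have h0 : r < (1 - (0 : ℝ)) ^ (1 / Q) := by simpa using hr1
    exact (hcont.eventually_const_lt h0).filter_mono nhdsWithin_le_nhds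
  obtain ⟨φ, hφr, hφ0, hφκ⟩ := (hev.and (Ioo_mem_nhdsGT hκ0)).exists
  set ψ := φ / 2 with hψ
  have hpow : ∀ t : ℝ, 0 ≤ 1 - t → ∀ k : ℕ, (1 - t) ^ ((k : ℝ) / Q) = ((1 - t) ^ (1 / Q)) ^ k := by
    intro t ht k
    rw [← Real.rpow_natCast, ← Real.rpow_mul ht]
    congr 1
    ring
  have hφ1 : 0 ≤ 1 - φ := by linarith
  have hψ1 : 0 < 1 - ψ := by linarith
  set b := (1 - ψ) ^ (1 / Q) with hb
  have hrb : r < b := hφr.trans (Real.rpow_lt_rpow hφ1 (by linarith) (by positivity))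
  have hb0 : 0 < b := hr0.trans hrb
  have hb1 : b < 1 := Real.rpow_lt_one hψ1.le (by linarith) (by positivity)
  refine ⟨φ, c, ψ, hφ0, hφκ, by linarith, by linarith, ?_⟩
  intro Ω _ P _ ξ x₁ x hrun
  have hE := hrate carath Ω P ξ x₁ x hrun
  have htend : ∀ᵐ ω ∂P, Tendsto
      (fun k : ℕ => (PSFW.objective f (x k ω) - PSFW.optValue C d f) / b ^ k) atTop (𝓝 0) := by
    -- The index is shifted by one because the run starts at k = 1; the ratio is r / b < 1.
    have h1 := PSFW.ae_tendsto_zero_of_integral_le_geometric (P := P)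
      (f := fun k ω => (PSFW.objective f (x (k + 1) ω) - PSFW.optValue C d f) / b ^ (k + 1))
      (fun k => (hE (k + 1) (by omega)).2.1.div_const _)
      (fun k ω => div_nonneg ((hE (k + 1) (by omega)).1 ω) (by positivity))
      (c := c * (r / b)) (θ := r / b) (by positivity) ((div_lt_one hb0).2 hrb) (fun k => by
        rw [integral_div, div_le_iff₀ (by positivity)]
        refine (hE (k + 1) (by omega)).2.2.trans_eq ?_
        rw [mul_assoc c, ← pow_succ', mul_assoc, ← mul_pow, div_mul_cancel₀ _ hb0.ne'])
    filter_upwards [h1] with ω hω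
    exact (tendsto_add_atTop_iff_nat 1).1 hω
  refine ⟨fun k hk => ⟨(hE (k + 1) (by omega)).2.1, ?_⟩, ?_, ?_⟩
  · rw [hpow φ hφ1]
    refine (hE (k + 1) (by omega)).2.2.trans ?_
    have h1 : r ^ (k + 1) ≤ r ^ k := pow_le_pow_of_le_one hr0.le hr1.le (by omega)
    have h2 : r ^ k ≤ ((1 - φ) ^ (1 / Q)) ^ k := pow_le_pow_left₀ hr0.le hφr.le k
    exact mul_le_mul_of_nonneg_left (h1.trans h2) hc
  · simp only [hpow ψ hψ1.le]
    exact htend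
  · filter_upwards [htend] with ω hω
    exact PSFW.convergesLinearly_of_tendsto hb0 hb1 hω
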